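/- Let $n\ge 3$ and let $\rho$ be an $n$-qubit quantum state (density matrix, pure or mixed) with qubits $A_1,\dots,A_n$. For a bipartite pure state $|\varphi\rangle$ of parties $A$ and $B$ let $C(|\varphi\rangle)=\sqrt{2[1-\mathrm{tr}(\rho_A^2)]}$, where $\rho_A=\mathrm{tr}_B|\varphi\rangle\langle\varphi|$, and for a bipartite mixed state $\sigma$ let $C(\sigma)=\min\sum_i w_iC(|\varphi_i\rangle)$, the minimum being over all pure state ensembles with $\sigma=\sum_i w_i|\varphi_i\rangle\langle\varphi_i|$, $w_i\ge 0$, $\sum_i w_i=1$. Write $C_{A_1A_i}$ for the concurrence of the reduced state of $\rho$ on the qubits $A_1,A_i$, and $C_{A_1|A_j\cdots A_n}$ for the concurrence of the reduced state of $\rho$ on $A_1,A_j,\dots,A_n$ with respect to the bipartition $A_1\,|\,A_j\cdots A_n$ ($2\le i,j\le n$). Let $k,p,\alpha,r$ be real numbers with $k\ge 1$, $\frac12\le p\le 1$, $r\ge 2$, $0\le\alpha\le\frac r2$, and put $$l=\frac{(1+k)^{\alpha/r}-p^{\alpha/r}}{k^{\alpha/r}}.$$ For $\alpha=0$ the convention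 $0^0=1$ is used. Then: (1) If $n\ge4$, $2\le m\le n-2$, $kC^r_{A_1A_i}\le C^r_{A_1|A_{i+1}\cdots A_n}$ for $i=2,\dots,m$ and $C^r_{A_1A_j}\ge kC^r_{A_1|A_{j+1}\cdots A_n}$ for $j=m+1,\dots,n-1$, then $$C^\alpha_{A_1|A_2\cdots A_n}\ge p^{\frac{\alpha}{r}}\sum_{i=2}^{m}l^{\,i-2}C^\alpha_{A_1A_i}+l^{m}\sum_{j=m+1}^{n-1}p^{\frac{(j-m-1)\alpha}{r}}C^\alpha_{A_1A_j}+l^{m-1}p^{\frac{(n-m-1)\alpha}{r}}C^\alpha_{A_1A_n}.$$ (2) If $kC^r_{A_1A_i}\le C^r_{A_1|A_{i+1}\cdots A_n}$ for $i=2,\dots,n-1$, then $$C^\alpha_{A_1|A_2\cdots A_n}\ge p^{\frac{\alpha}{r}}\sum_{i=2}^{n-1}l^{\,i-2}C^\alpha_{A_1A_i}+l^{n-2}C^\alpha_{A_1A_n}.$$ (3) If $C^r_{A_1A_j}\ge kC^r_{A_1|A_{j+1}\cdots A_n}$ for $j=2,\dots,n-1$, then $$C^\alpha_{A_1|A_2\cdots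 A_n}\ge l\sum_{j=2}^{n-1}p^{\frac{(j-2)\alpha}{r}}C^\alpha_{A_1A_j}+p^{\frac{(n-2)\alpha}{r}}C^\alpha_{A_1A_n}.$$ -/

import Mathlib

open scoped ComplexOrder

noncomputable section

/-- A density matrix (quantum state): positive semidefinite with trace one. -/
def IsDensityMatrix {ι : Type*} [Fintype ι] (ρ : Matrix ι ι ℂ) : Prop :=
  ρ.PosSemidef ∧ ρ.trace = 1

/-- A normalized state vector. -/
def IsStateVector {ι : Type*} [Fintype ι] (ψ : ι → ℂ) : Prop :=
  ∑ x, ‖ψ x‖ ^ 2 = 1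

/-- The operator `|ψ⟩⟨ψ|`. -/
def pureState {ι : Type*} (ψ : ι → ℂ) : Matrix ι ι ℂ :=
  Matrix.vecMulVec ψ (star ψ)

/-- The partial trace over the second factor of a bipartite system. -/
def traceSecond {ι κ : Type*} [Fintype κ] (ρ : Matrix (ι × κ) (ι × κ) ℂ) : Matrix ι ι ℂ :=
  Matrix.of fun a b => ∑ c, ρ (a, c) (b, c)

/-- Concurrence `√(2 (1 - tr ρ_A²))` of a bipartite pure state, where `ρ_A` is the reduced
density matrix of the first party. -/
def pureConcurrence {ι κ : Type*} [Fintype ι] [Fintype κ] (ψ : ι × κ → ℂ) : ℝ :=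
  Real.sqrt (2 * (1 - (Matrix.trace (traceSecond (pureState ψ) * traceSecond (pureState ψ))).re))

/-- The finite pure state ensemble `{w i, ψ i}` realizes `ρ`. -/
structure IsPureEnsemble {ι : Type*} [Fintype ι] {N : ℕ}
    (w : Fin N → ℝ) (ψ : Fin N → ι → ℂ) (ρ : Matrix ι ι ℂ) : Prop where
  nonneg : ∀ i, 0 ≤ w i
  sum_eq_one : ∑ i, w i = 1
  isStateVector : ∀ i, IsStateVector (ψ i)
  eq_sum : ρ = ∑ i, (w i : ℂ) • pureState (ψ i)

/-- Concurrence of a bipartite mixed state: the convex roof of the pure state concurrence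
over all finite pure state ensembles that realize `ρ`. -/
def concurrence {ι κ : Type*} [Fintype ι] [Fintype κ] (ρ : Matrix (ι × κ) (ι × κ) ℂ) : ℝ :=
  sInf {c : ℝ | ∃ (N : ℕ) (w : Fin N → ℝ) (ψ : Fin N → ι × κ → ℂ),
    IsPureEnsemble w ψ ρ ∧ c = ∑ i, w i * pureConcurrence (ψ i)}

/-- For disjoint sets `A`, `B` of qubits, the reduced density matrix of a multi-qubit state on
the qubits of `A ∪ B` (all other qubits are traced out), as a bipartite state of `A` and `B`.
The computational basis of the system with qubit set `ι` is indexed by `ι → Fin 2`. -/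
def reducedState {ι : Type*} [Fintype ι] [DecidableEq ι]
    (ρ : Matrix (ι → Fin 2) (ι → Fin 2) ℂ) (A B : Finset ι) :
    Matrix ((A → Fin 2) × (B → Fin 2)) ((A → Fin 2) × (B → Fin 2)) ℂ :=
  Matrix.of fun u v => ∑ x : ι → Fin 2, ∑ y : ι → Fin 2,
    if A.restrict x = u.1 ∧ B.restrict x = u.2 ∧ A.restrict y = v.1 ∧ B.restrict y = v.2 ∧
      (∀ q, q ∉ A ∪ B → x q = y q) then ρ x y else 0

/-- The set consisting of the qubit `A_i`, where the qubits `A_1, …, A_n` are labelled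
by the elements `0, …, n - 1` of `Fin n`. -/
def qubit (n i : ℕ) : Finset (Fin n) := {q | q.val + 1 = i}

/-- The set of the qubits `A_j, A_{j+1}, …, A_n`. -/
def qubitsFrom (n j : ℕ) : Finset (Fin n) := {q | j ≤ q.val + 1}

/-- `C_{A_1 A_i}`: concurrence of the two-qubit reduced state of `A_1` and `A_i`, for `i ≥ 2`. -/
def pairConcurrence {n : ℕ} (ρ : Matrix (Fin n → Fin 2) (Fin n → Fin 2) ℂ) (i : ℕ) : ℝ :=
  concurrence (reducedState ρ (qubit n 1) (qubit n i))

/-- `C_{A_1|A_j ⋯ A_n}`: concurrence of the reduced state of `A_1, A_j, …, A_n` under the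
bipartition `A_1 | A_j ⋯ A_n`, for `j ≥ 2`. -/
def tailConcurrence {n : ℕ} (ρ : Matrix (Fin n → Fin 2) (Fin n → Fin 2) ℂ) (j : ℕ) : ℝ :=
  concurrence (reducedState ρ (qubit n 1) (qubitsFrom n j))

/-- The weight `l = ((1 + k)^(α/r) - p^(α/r)) / k^(α/r)`. -/
def monogamyWeight (k p α r : ℝ) : ℝ :=
  ((1 + k) ^ (α / r) - p ^ (α / r)) / k ^ (α / r)

end

/-!
# Weighted monogamy relations for powers of the concurrence

Everything rests on the monogamy inequality `C(A|B)² + C(A|C)² ≤ C(A|BC)²` for qubits `A`, `B` and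
an arbitrary finite-dimensional system `C` (`concurrence_monogamy`). Applied to the reduced states
with `A = A_1`, `B = A_j` and `C = A_{j+1} ⋯ A_n`, it compares consecutive tail concurrences
(`tailConcurrence_monogamy`). Since `r ≥ 2`, it persists for `r`-th powers, and with `x = α / r` the
elementary inequality `p ^ x * a ^ x + l * b ^ x ≤ (a + b) ^ x` for `k * a ≤ b`
(`rpow_mul_rpow_add_weight_le`) turns it into a linear recursion for `α`-th powers, whose iteration
gives the three claims. The elementary inequality holds because `(1 + s) ^ x - l * s ^ x` is
monotone for `s ≥ k`, which uses `(1 + k) ^ (x - 1) ≤ 2 ^ (-x) ≤ p ^ x` for `x ≤ 1 / 2`.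

For a pure state of `ABC`, monogamy is proved by exhibiting ensembles for `AB` and `AC`. The vector
is a family `W k` of `2 × 2` matrices indexed by the basis of `C`. If all matrices in its linear
span are singular, then the `W k` are product vectors and `C(A|B) = 0`. Otherwise at most two steps
of a Takagi factorization of the polarized determinant (`exists_bilin_orthogonal`) produce local
filters `S`, `T` after which the state of `AB` is an X-state: the entries `00` and `11`, as vectors
indexed by the basis of `C`, are orthogonal to the entries `01` and `10`
(`exists_filter_orthogonal`).
Let `p, q, u, v` be the squared norms of the entries `00, 11, 01, 10`.

* An explicit ensemble of the X-state gives `C(A|B) ≤ 2 |√p √q - √u √v| / (|det S| |det T|)`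
  (`concurrence_le_of_filter`).
* For a Hermitian `Z` with negative determinant, measuring `B` in the eigenbasis of `Z` bounds
  `C(A|C)²` by `C(A|BC)² + 4 det (∑ W k Z (W k)ᴴ) / (-det Z)` (`concurrence_traceMiddle_sq_le`). For
  `Z = T diag(1, -t) Tᴴ` the determinant in the numerator is `(p - t u) (v - t q) / |det S|²`, and
  in the limit of optimal `t > 0` the added term is minus the square of the bound on `C(A|B)`.

The inequality extends to mixed states by convexity of the concurrence and Minkowski's inequality.
-/

/-- The concurrence of a bipartite vector that need not be normalized. It is homogeneous of degree
two in the vector, so that weights of an ensemble can be absorbed into its vectors. -/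
noncomputable def vectorConcurrence {ι κ : Type*} [Fintype ι] [Fintype κ] (φ : ι × κ → ℂ) : ℝ :=
  Real.sqrt (2 * ((∑ x, ‖φ x‖ ^ 2) ^ 2 -
    (Matrix.trace (traceSecond (pureState φ) * traceSecond (pureState φ))).re))

/-! ### Ensembles of unnormalized vectors -/

section Ensembles

variable {ι κ : Type*} [Fintype ι] [Fintype κ]

theorem pureState_apply {ι : Type*} (φ : ι → ℂ) (x y : ι) :
    pureState φ x y = φ x * star (φ y) := rfl

theorem pureState_smul {ι : Type*} (s : ℝ) (φ : ι → ℂ) :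
    pureState (fun x => (s : ℂ) * φ x) = ((s ^ 2 : ℝ) : ℂ) • pureState φ := by
  ext x y
  simp only [pureState_apply, Matrix.smul_apply, smul_eq_mul, star_mul', Complex.star_def,
    Complex.conj_ofReal, Complex.ofReal_pow]
  ring

theorem trace_pureState {ι : Type*} [Fintype ι] (φ : ι → ℂ) :
    (pureState φ).trace = ((∑ x, ‖φ x‖ ^ 2 : ℝ) : ℂ) := by
  simp only [Matrix.trace, Matrix.diag_apply, pureState_apply, Complex.star_def, Complex.mul_conj,
    Complex.normSq_eq_norm_sq, Complex.ofReal_sum]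

theorem traceSecond_smul {ι κ : Type*} [Fintype κ] (s : ℂ) (ρ : Matrix (ι × κ) (ι × κ) ℂ) :
    traceSecond (s • ρ) = s • traceSecond ρ := by
  ext a b
  simp [traceSecond, Finset.mul_sum]

theorem vectorConcurrence_smul (s : ℝ) (φ : ι × κ → ℂ) :
    vectorConcurrence (fun x => (s : ℂ) * φ x) = s ^ 2 * vectorConcurrence φ := by
  unfold vectorConcurrence
  rw [pureState_smul, traceSecond_smul, Matrix.smul_mul, Matrix.mul_smul, Matrix.trace_smul,
    Matrix.trace_smul, smul_eq_mul, smul_eq_mul, Complex.re_ofReal_mul, Complex.re_ofReal_mul]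
  simp only [norm_mul, mul_pow, Complex.norm_real, Real.norm_eq_abs, sq_abs, ← Finset.mul_sum]
  rw [← Real.sqrt_sq (sq_nonneg s), ← Real.sqrt_mul (by positivity), Real.sqrt_sq (sq_nonneg s)]
  congr 1
  ring

theorem pureConcurrence_eq_vectorConcurrence {ψ : ι × κ → ℂ} (h : IsStateVector ψ) :
    pureConcurrence ψ = vectorConcurrence ψ := by
  unfold pureConcurrence vectorConcurrence
  rw [show ∑ x, ‖ψ x‖ ^ 2 = 1 from h, one_pow]

theorem pureConcurrence_nonneg (ψ : ι × κ → ℂ) : 0 ≤ pureConcurrence ψ := Real.sqrt_nonneg _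

theorem isStateVector_single [DecidableEq ι] (x : ι) : IsStateVector (Pi.single x (1 : ℂ)) := by
  unfold IsStateVector
  rw [Finset.sum_eq_single x] <;> simp +contextual

/-- A decomposition of a state into unnormalized vectors yields a pure state ensemble with the
same average concurrence. -/
theorem exists_isPureEnsemble {N : ℕ} {ρ : Matrix (ι × κ) (ι × κ) ℂ} (htr : ρ.trace = 1)
    (φ : Fin N → ι × κ → ℂ) (hρ : ρ = ∑ i, pureState (φ i)) :
    ∃ (w : Fin N → ℝ) (ψ : Fin N → ι × κ → ℂ), IsPureEnsemble w ψ ρ ∧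
      ∑ i, w i * pureConcurrence (ψ i) = ∑ i, vectorConcurrence (φ i) := by
  classical
  have hne : Nonempty (ι × κ) := by
    by_contra h
    rw [not_nonempty_iff] at h
    simp [Matrix.trace] at htr
  obtain ⟨x₀⟩ := hne
  set w : Fin N → ℝ := fun i => ∑ x, ‖φ i x‖ ^ 2 with hw
  have hw0 : ∀ i, 0 ≤ w i := fun i => Finset.sum_nonneg fun x _ => by positivity
  -- A vector of weight zero is replaced by an arbitrary normalized one.
  set ψ : Fin N → ι × κ → ℂ := fun i =>
    if w i = 0 then Pi.single x₀ 1 else fun x => ((√(w i))⁻¹ : ℝ) * φ i x with hψ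
  have hφ : ∀ i, φ i = fun x => ((√(w i) : ℝ) : ℂ) * ψ i x := by
    intro i
    ext x
    by_cases h : w i = 0
    · have h1 := (Finset.sum_eq_zero_iff_of_nonneg (fun x _ => by positivity)).1 h x
        (Finset.mem_univ x)
      simp only [h, Real.sqrt_zero, Complex.ofReal_zero, zero_mul]
      simpa using h1
    · have h2 : √(w i) ≠ 0 := by
        rw [Real.sqrt_ne_zero (hw0 i)]; exact h
      simp only [hψ, if_neg h]
      rw [← mul_assoc, ← Complex.ofReal_mul, mul_inv_cancel₀ h2, Complex.ofReal_one, one_mul]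
  have hst : ∀ i, IsStateVector (ψ i) := by
    intro i
    by_cases h : w i = 0
    · simp only [hψ, if_pos h]
      exact isStateVector_single x₀
    · simp only [hψ, if_neg h, IsStateVector, norm_mul, mul_pow, ← Finset.mul_sum]
      change _ * w i = 1
      rw [Complex.norm_real, Real.norm_eq_abs, sq_abs, inv_pow, Real.sq_sqrt (hw0 i),
        inv_mul_cancel₀ h]
  refine ⟨w, ψ, ⟨hw0, ?_, hst, ?_⟩, ?_⟩
  · rw [hρ, Matrix.trace_sum] at htr
    simp only [trace_pureState] at htr
    exact_mod_cast htr
  · rw [hρ]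
    refine Finset.sum_congr rfl fun i _ => ?_
    conv_lhs => rw [hφ i]
    rw [pureState_smul, Real.sq_sqrt (hw0 i)]
  · refine Finset.sum_congr rfl fun i _ => ?_
    conv_rhs => rw [hφ i]
    rw [vectorConcurrence_smul, Real.sq_sqrt (hw0 i), pureConcurrence_eq_vectorConcurrence (hst i)]

theorem sum_mul_pureConcurrence_nonneg {N : ℕ} {ρ : Matrix (ι × κ) (ι × κ) ℂ}
    {w : Fin N → ℝ} {ψ : Fin N → ι × κ → ℂ} (h : IsPureEnsemble w ψ ρ) :
    0 ≤ ∑ i, w i * pureConcurrence (ψ i) :=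
  Finset.sum_nonneg fun i _ => mul_nonneg (h.nonneg i) (pureConcurrence_nonneg _)

theorem concurrence_nonneg (ρ : Matrix (ι × κ) (ι × κ) ℂ) : 0 ≤ concurrence ρ := by
  refine Real.sInf_nonneg ?_
  rintro c ⟨N, w, ψ, h, rfl⟩
  exact sum_mul_pureConcurrence_nonneg h

theorem concurrence_le_of_isPureEnsemble {N : ℕ} {ρ : Matrix (ι × κ) (ι × κ) ℂ}
    {w : Fin N → ℝ} {ψ : Fin N → ι × κ → ℂ} (h : IsPureEnsemble w ψ ρ) :
    concurrence ρ ≤ ∑ i, w i * pureConcurrence (ψ i) := by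
  refine csInf_le ⟨0, ?_⟩ ⟨N, w, ψ, h, rfl⟩
  rintro c ⟨N, w, ψ, h, rfl⟩
  exact sum_mul_pureConcurrence_nonneg h

theorem concurrence_le_sum_vectorConcurrence {J : Type*} [Fintype J]
    {ρ : Matrix (ι × κ) (ι × κ) ℂ} (htr : ρ.trace = 1)
    (φ : J → ι × κ → ℂ) (hρ : ρ = ∑ i, pureState (φ i)) :
    concurrence ρ ≤ ∑ i, vectorConcurrence (φ i) := by
  let e := (Fintype.equivFin J).symm
  obtain ⟨w, ψ, h, h'⟩ := exists_isPureEnsemble htr (fun i => φ (e i))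
    (by rw [hρ, ← e.sum_comp])
  rw [← e.sum_comp, ← h']
  exact concurrence_le_of_isPureEnsemble h

open scoped MatrixOrder Matrix.Norms.L2Operator in
theorem Matrix.PosSemidef.exists_eq_conjTranspose_mul_self {ι : Type*} [Fintype ι]
    {ρ : Matrix ι ι ℂ} (h : ρ.PosSemidef) : ∃ B : Matrix ι ι ℂ, ρ = B.conjTranspose * B := by
  classical
  exact CStarAlgebra.nonneg_iff_eq_star_mul_self.1 (Matrix.nonneg_iff_posSemidef.2 h)

theorem IsDensityMatrix.exists_isPureEnsemble {ρ : Matrix (ι × κ) (ι × κ) ℂ}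
    (h : IsDensityMatrix ρ) :
    ∃ (N : ℕ) (w : Fin N → ℝ) (ψ : Fin N → ι × κ → ℂ), IsPureEnsemble w ψ ρ := by
  classical
  obtain ⟨B, hB⟩ := h.1.exists_eq_conjTranspose_mul_self
  let e := (Fintype.equivFin (ι × κ)).symm
  obtain ⟨w, ψ, h, -⟩ := _root_.exists_isPureEnsemble h.2 (fun i x => star (B (e i) x)) (by
    rw [hB, e.sum_comp (fun j => pureState fun x => star (B j x))]
    ext x y
    simp [Matrix.mul_apply, Matrix.sum_apply, pureState_apply])
  exact ⟨_, w, ψ, h⟩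

theorem IsDensityMatrix.exists_sum_lt {ρ : Matrix (ι × κ) (ι × κ) ℂ} (h : IsDensityMatrix ρ)
    {ε : ℝ} (hε : 0 < ε) :
    ∃ (N : ℕ) (w : Fin N → ℝ) (ψ : Fin N → ι × κ → ℂ), IsPureEnsemble w ψ ρ ∧
      ∑ i, w i * pureConcurrence (ψ i) < concurrence ρ + ε := by
  obtain ⟨N, w, ψ, h⟩ := h.exists_isPureEnsemble
  obtain ⟨c, ⟨N, w, ψ, h, rfl⟩, hc⟩ := exists_lt_of_csInf_lt (s := {c : ℝ |
    ∃ (N : ℕ) (w : Fin N → ℝ) (ψ : Fin N → ι × κ → ℂ),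
    IsPureEnsemble w ψ ρ ∧ c = ∑ i, w i * pureConcurrence (ψ i)}) ⟨_, N, w, ψ, h, rfl⟩
    (lt_add_of_pos_right (concurrence ρ) hε)
  exact ⟨N, w, ψ, h, hc⟩

theorem pureState_posSemidef {ι : Type*} [Fintype ι] (φ : ι → ℂ) : (pureState φ).PosSemidef :=
  Matrix.posSemidef_vecMulVec_self_star φ

/-- The concurrence is convex. -/
theorem concurrence_sum_le {N : ℕ} {w : Fin N → ℝ} (hw : ∀ i, 0 ≤ w i) (hw1 : ∑ i, w i = 1)
    {ρ : Fin N → Matrix (ι × κ) (ι × κ) ℂ} (hρ : ∀ i, IsDensityMatrix (ρ i)) :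
    concurrence (∑ i, (w i : ℂ) • ρ i) ≤ ∑ i, w i * concurrence (ρ i) := by
  refine le_of_forall_pos_lt_add fun ε hε => ?_
  choose M v ψ hψ hlt using fun i => (hρ i).exists_sum_lt (half_pos hε)
  have htr : (∑ i, (w i : ℂ) • ρ i).trace = 1 := by
    simp only [Matrix.trace_sum, Matrix.trace_smul, (hρ _).2, smul_eq_mul, mul_one]
    exact_mod_cast hw1
  have key := concurrence_le_sum_vectorConcurrence (J := Σ i, Fin (M i)) htr
    (fun j x => ((√(w j.1 * v j.1 j.2) : ℝ) : ℂ) * ψ j.1 j.2 x) (by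
      rw [Fintype.sum_sigma]
      refine Finset.sum_congr rfl fun i _ => ?_
      rw [(hψ i).eq_sum, Finset.smul_sum]
      refine Finset.sum_congr rfl fun j _ => ?_
      rw [pureState_smul, Real.sq_sqrt (mul_nonneg (hw i) ((hψ i).nonneg j)), smul_smul,
        Complex.ofReal_mul])
  refine key.trans_lt ?_
  rw [Fintype.sum_sigma]
  calc ∑ i, ∑ j, vectorConcurrence (fun x => ((√(w i * v i j) : ℝ) : ℂ) * ψ i j x)
      = ∑ i, w i * ∑ j, v i j * pureConcurrence (ψ i j) := by
        refine Finset.sum_congr rfl fun i _ => ?_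
        rw [Finset.mul_sum]
        refine Finset.sum_congr rfl fun j _ => ?_
        rw [vectorConcurrence_smul, Real.sq_sqrt (mul_nonneg (hw i) ((hψ i).nonneg j)),
          pureConcurrence_eq_vectorConcurrence ((hψ i).isStateVector j), mul_assoc]
    _ ≤ ∑ i, w i * (concurrence (ρ i) + ε / 2) :=
        Finset.sum_le_sum fun i _ => mul_le_mul_of_nonneg_left (hlt i).le (hw i)
    _ = ∑ i, w i * concurrence (ρ i) + ε / 2 := by
        simp only [mul_add, Finset.sum_add_distrib, ← Finset.sum_mul, hw1, one_mul]
    _ < _ := by linarith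

end Ensembles

/-! ### Takagi factorization and normal forms of `2 × 2` matrices -/

section Takagi

/-- The first step of a Takagi factorization: a maximizer of `‖B x x‖` on the unit sphere. -/
theorem exists_bilin_orthogonal {E : Type*} [NormedAddCommGroup E] [InnerProductSpace ℂ E]
    [FiniteDimensional ℂ E] (B : E →ₗ[ℂ] E →ₗ[ℂ] ℂ) (hB : ∀ x y, B x y = B y x)
    (hne : ∃ x, B x x ≠ 0) :
    ∃ x, B x x ≠ 0 ∧ ∀ y, inner ℂ x y = 0 → B x y = 0 := by
  obtain ⟨v, hv⟩ := hne
  have hv0 : v ≠ 0 := by rintro rfl; simp at hv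
  have hcont : Continuous fun x => ‖B x x‖ := by
    have h2 : Continuous fun x => B x x := by
      let B' : E →ₗ[ℂ] E →L[ℂ] ℂ := LinearMap.toContinuousLinearMap.toLinearMap ∘ₗ B
      have hB' : Continuous B' := B'.continuous_of_finiteDimensional
      exact hB'.clm_apply continuous_id
    exact h2.norm
  have : ProperSpace E := FiniteDimensional.proper_rclike ℂ E
  obtain ⟨x, hx, hmax⟩ := (isCompact_sphere (0 : E) 1).exists_isMaxOn
    ⟨(((‖v‖⁻¹ : ℝ) : ℂ)) • v, by
      simp [norm_smul, hv0]⟩ hcont.continuousOn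
  have hx1 : ‖x‖ = 1 := by simpa using hx
  have hbound : ∀ y, ‖B y y‖ ≤ ‖B x x‖ * ‖y‖ ^ 2 := by
    intro y
    by_cases hy : y = 0
    · simp [hy]
    have hy' : ‖y‖ ≠ 0 := by simpa using hy
    have h := hmax (a := (((‖y‖⁻¹ : ℝ) : ℂ)) • y) (by simp [norm_smul, hy])
    simp only [Set.mem_ofPred_eq, map_smul, LinearMap.smul_apply, smul_eq_mul, norm_mul,
      Complex.norm_real, norm_inv, norm_norm] at h
    calc ‖B y y‖ = (‖y‖⁻¹ * (‖y‖⁻¹ * ‖B y y‖)) * ‖y‖ ^ 2 := by field_simp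
      _ ≤ _ := by gcongr
  have hβ : B x x ≠ 0 := by
    intro h0
    have := hbound v
    rw [h0, norm_zero, zero_mul] at this
    exact hv (norm_le_zero_iff.1 this)
  refine ⟨x, hβ, fun y hxy => ?_⟩
  -- Rotate `y` so that the first order term of `B (x + t y) (x + t y)` is in phase with `B x x`.
  by_contra hb
  set β := B x x
  set b := B x y
  set z : E := (β / b) • y with hz
  have hxz : inner ℂ x z = 0 := by rw [hz, inner_smul_right, hxy, mul_zero]
  have hbz : B x z = β := by
    rw [hz, map_smul, smul_eq_mul]; field_simp
    rfl
  have key : ∀ t : ℝ, 0 < t → 2 * ‖β‖ ≤ t * (‖β‖ * ‖z‖ ^ 2 + ‖B z z‖) := by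
    intro t ht
    have h1 := hbound (x + (t : ℂ) • z)
    have h2 : ‖x + (t : ℂ) • z‖ ^ 2 = 1 + t ^ 2 * ‖z‖ ^ 2 := by
      have := norm_add_sq_eq_norm_sq_add_norm_sq_of_inner_eq_zero x ((t : ℂ) • z)
        (by rw [inner_smul_right, hxz, mul_zero])
      rw [pow_two, this, hx1, norm_smul, Complex.norm_real, Real.norm_eq_abs]
      nlinarith [sq_abs t]
    have h3 : B (x + (t : ℂ) • z) (x + (t : ℂ) • z)
        = ((1 + 2 * t : ℝ) : ℂ) * β + ((t ^ 2 : ℝ) : ℂ) * B z z := by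
      simp only [map_add, map_smul, LinearMap.add_apply, LinearMap.smul_apply, smul_eq_mul,
        hB z x, hbz]
      change β + _ + _ = _
      push_cast
      ring
    rw [h2, h3] at h1
    have h4 := norm_sub_norm_le (((1 + 2 * t : ℝ) : ℂ) * β) (-(((t ^ 2 : ℝ) : ℂ) * B z z))
    rw [sub_neg_eq_add, norm_neg, norm_mul, norm_mul, Complex.norm_real, Complex.norm_real,
      Real.norm_of_nonneg (by positivity), Real.norm_of_nonneg (by positivity)] at h4
    have h5 : t * (2 * ‖β‖) ≤ t * (t * (‖β‖ * ‖z‖ ^ 2 + ‖B z z‖)) := by nlinarith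
    exact le_of_mul_le_mul_left h5 ht
  have hβ0 : 0 < ‖β‖ := norm_pos_iff.2 hβ
  set K := ‖β‖ * ‖z‖ ^ 2 + ‖B z z‖ with hK
  have hK0 : 0 ≤ K := by positivity
  have := key (‖β‖ / (K + 1)) (by positivity)
  have h6 : ‖β‖ / (K + 1) * K ≤ ‖β‖ := by
    rw [div_mul_eq_mul_div, div_le_iff₀ (by positivity)]
    nlinarith
  linarith

open Matrix

/-- The polar form `det (X + Y) - det X - det Y` of the determinant of `2 × 2` matrices, pulled back
along `w`. -/
noncomputable def polarDet {E : Type*} [AddCommGroup E] [Module ℂ E]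
    (w : E →ₗ[ℂ] Matrix (Fin 2) (Fin 2) ℂ) : E →ₗ[ℂ] E →ₗ[ℂ] ℂ :=
  LinearMap.mk₂ ℂ (fun x y => w x 0 0 * w y 1 1 + w x 1 1 * w y 0 0
      - w x 0 1 * w y 1 0 - w x 1 0 * w y 0 1)
    (fun x y z => by simp only [map_add, Matrix.add_apply]; ring)
    (fun c x y => by simp only [map_smul, Matrix.smul_apply, smul_eq_mul]; ring)
    (fun x y z => by simp only [map_add, Matrix.add_apply]; ring)
    (fun c x y => by simp only [map_smul, Matrix.smul_apply, smul_eq_mul]; ring)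

theorem polarDet_apply {E : Type*} [AddCommGroup E] [Module ℂ E]
    (w : E →ₗ[ℂ] Matrix (Fin 2) (Fin 2) ℂ) (x y : E) :
    polarDet w x y = w x 0 0 * w y 1 1 + w x 1 1 * w y 0 0
      - w x 0 1 * w y 1 0 - w x 1 0 * w y 0 1 := rfl

theorem polarDet_self {E : Type*} [AddCommGroup E] [Module ℂ E]
    (w : E →ₗ[ℂ] Matrix (Fin 2) (Fin 2) ℂ) (x : E) : polarDet w x x = 2 * (w x).det := by
  rw [polarDet_apply, Matrix.det_fin_two]; ring

theorem exists_det_ne_zero_orthogonal {E : Type*} [NormedAddCommGroup E] [InnerProductSpace ℂ E]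
    [FiniteDimensional ℂ E] (w : E →ₗ[ℂ] Matrix (Fin 2) (Fin 2) ℂ)
    (hne : ∃ x, (w x).det ≠ 0) :
    ∃ x, (w x).det ≠ 0 ∧ ∀ y, inner ℂ x y = 0 → polarDet w x y = 0 := by
  obtain ⟨x, hx, h⟩ := exists_bilin_orthogonal (polarDet w)
    (fun x y => by simp only [polarDet_apply]; ring) (by
      obtain ⟨x, hx⟩ := hne
      exact ⟨x, by rw [polarDet_self]; simpa using hx⟩)
  exact ⟨x, by rw [polarDet_self] at hx; simpa using hx, h⟩

theorem exists_adjugate_mul_mul_diagonal (N : Matrix (Fin 2) (Fin 2) ℂ) (htr : N.trace = 0)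
    (hdet : N.det ≠ 0) :
    ∃ T : Matrix (Fin 2) (Fin 2) ℂ, T.det ≠ 0 ∧
      (T.adjugate * N * T) 0 1 = 0 ∧ (T.adjugate * N * T) 1 0 = 0 := by
  rw [Matrix.trace_fin_two] at htr
  rw [Matrix.det_fin_two] at hdet
  have h11 : N 1 1 = - N 0 0 := by linear_combination htr
  rw [h11] at hdet
  obtain ⟨μ, hμ⟩ := IsAlgClosed.exists_pow_nat_eq (N 0 0 ^ 2 + N 0 1 * N 1 0) (n := 2) (by norm_num)
  have hμ0 : μ ≠ 0 := by
    rintro rfl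
    apply hdet
    linear_combination hμ
  by_cases hb : N 0 1 = 0
  · by_cases hc : N 1 0 = 0
    · exact ⟨1, by simp, by simp [hb], by simp [hc]⟩
    · refine ⟨!![N 0 0 + μ, N 0 0 - μ; N 1 0, N 1 0], ?_, ?_, ?_⟩
      · rw [Matrix.det_fin_two_of]
        have : (N 0 0 + μ) * N 1 0 - (N 0 0 - μ) * N 1 0 = 2 * (μ * N 1 0) := by ring
        rw [this]; simp [hμ0, hc]
      · simp only [Matrix.adjugate_fin_two_of, Matrix.mul_apply, Fin.sum_univ_two, h11,
          Matrix.of_apply, Matrix.cons_val', Matrix.cons_val_zero, Matrix.cons_val_one,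
          Matrix.cons_val_fin_one]
        linear_combination -(N 1 0) * hμ
      · simp only [Matrix.adjugate_fin_two_of, Matrix.mul_apply, Fin.sum_univ_two, h11,
          Matrix.of_apply, Matrix.cons_val', Matrix.cons_val_zero, Matrix.cons_val_one,
          Matrix.cons_val_fin_one]
        linear_combination (N 1 0) * hμ
  · refine ⟨!![N 0 1, N 0 1; μ - N 0 0, -μ - N 0 0], ?_, ?_, ?_⟩
    · rw [Matrix.det_fin_two_of]
      have : N 0 1 * (-μ - N 0 0) - N 0 1 * (μ - N 0 0) = -2 * (μ * N 0 1) := by ring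
      rw [this]; simp [hμ0, hb]
    · simp only [Matrix.adjugate_fin_two_of, Matrix.mul_apply, Fin.sum_univ_two, h11,
        Matrix.of_apply, Matrix.cons_val', Matrix.cons_val_zero, Matrix.cons_val_one,
        Matrix.cons_val_fin_one]
      linear_combination (N 0 1) * hμ
    · simp only [Matrix.adjugate_fin_two_of, Matrix.mul_apply, Fin.sum_univ_two, h11,
        Matrix.of_apply, Matrix.cons_val', Matrix.cons_val_zero, Matrix.cons_val_one,
        Matrix.cons_val_fin_one]
      linear_combination -(N 0 1) * hμ

theorem exists_adjugate_mul_mul_strictUpper (N : Matrix (Fin 2) (Fin 2) ℂ) (htr : N.trace = 0)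
    (hdet : N.det = 0) :
    ∃ T : Matrix (Fin 2) (Fin 2) ℂ, T.det ≠ 0 ∧ (T.adjugate * N * T) 0 0 = 0 ∧
      (T.adjugate * N * T) 1 0 = 0 ∧ (T.adjugate * N * T) 1 1 = 0 := by
  rw [Matrix.trace_fin_two] at htr
  rw [Matrix.det_fin_two] at hdet
  have h11 : N 1 1 = - N 0 0 := by linear_combination htr
  rw [h11] at hdet
  by_cases hc : N 1 0 = 0
  · have ha : N 0 0 = 0 := by
      rw [hc] at hdet
      have : N 0 0 ^ 2 = 0 := by linear_combination -hdet
      exact pow_eq_zero_iff (by norm_num) |>.1 this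
    exact ⟨1, by simp, by simp [ha], by simp [hc], by simp [h11, ha]⟩
  · refine ⟨!![N 0 0, 1; N 1 0, 0], by simpa [Matrix.det_fin_two_of] using hc, ?_, ?_, ?_⟩ <;>
    simp only [Matrix.adjugate_fin_two_of, Matrix.mul_apply, Fin.sum_univ_two, h11,
        Matrix.of_apply, Matrix.cons_val', Matrix.cons_val_zero, Matrix.cons_val_one,
        Matrix.cons_val_fin_one]
    · ring
    · linear_combination N 1 0 * hdet
    · ring

end Takagi

/-! ### Filtering a family of `2 × 2` matrices to X-form -/

section NormalForm

open Matrix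

theorem trace_adjugate_mul_mul (T W : Matrix (Fin 2) (Fin 2) ℂ) :
    (T.adjugate * W * T) 0 0 + (T.adjugate * W * T) 1 1 = T.det * (W 0 0 + W 1 1) := by
  simp only [Matrix.adjugate_fin_two, Matrix.mul_apply, Fin.sum_univ_two, Matrix.det_fin_two,
    Matrix.of_apply, Matrix.cons_val', Matrix.cons_val_zero, Matrix.cons_val_one,
    Matrix.cons_val_fin_one]
  ring

theorem polar_adjugate_mul_mul (T N W : Matrix (Fin 2) (Fin 2) ℂ) :
    (T.adjugate * N * T) 0 0 * (T.adjugate * W * T) 1 1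
      + (T.adjugate * N * T) 1 1 * (T.adjugate * W * T) 0 0
      - (T.adjugate * N * T) 0 1 * (T.adjugate * W * T) 1 0
      - (T.adjugate * N * T) 1 0 * (T.adjugate * W * T) 0 1
      = T.det ^ 2 * (N 0 0 * W 1 1 + N 1 1 * W 0 0 - N 0 1 * W 1 0 - N 1 0 * W 0 1) := by
  simp only [Matrix.adjugate_fin_two, Matrix.mul_apply, Fin.sum_univ_two, Matrix.det_fin_two,
    Matrix.of_apply, Matrix.cons_val', Matrix.cons_val_zero, Matrix.cons_val_one,
    Matrix.cons_val_fin_one]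
  ring

theorem det_adjugate_mul_mul (T W : Matrix (Fin 2) (Fin 2) ℂ) :
    (T.adjugate * W * T).det = T.det ^ 2 * W.det := by
  rw [Matrix.det_mul, Matrix.det_mul, Matrix.det_adjugate]
  simp
  ring

/-- Up to invertible `2 × 2` matrices on both sides, a linear family of `2 × 2` matrices on a
finite-dimensional Hilbert space, not all of whose members are singular, consists of diagonal
matrices on a subspace and of antidiagonal ones on its orthogonal complement. For the family of
the conditional states of two qubits this means that local filters bring the two-qubit state into
the form of an X-state. -/
theorem exists_filter_diagonal_antidiagonal {E : Type*} [NormedAddCommGroup E]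
    [InnerProductSpace ℂ E] [FiniteDimensional ℂ E] (w : E →ₗ[ℂ] Matrix (Fin 2) (Fin 2) ℂ)
    (hne : ∃ x, (w x).det ≠ 0) :
    ∃ (S T : Matrix (Fin 2) (Fin 2) ℂ) (U : Submodule ℂ E), S.det ≠ 0 ∧ T.det ≠ 0 ∧
      (∀ y ∈ U, (S * w y * T) 0 1 = 0 ∧ (S * w y * T) 1 0 = 0) ∧
      (∀ y ∈ Uᗮ, (S * w y * T) 0 0 = 0 ∧ (S * w y * T) 1 1 = 0) := by
  obtain ⟨x₁, hx₁, horth₁⟩ := exists_det_ne_zero_orthogonal w hne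
  -- After multiplication by `adj (w x₁)`, the vector `x₁` is mapped to a scalar matrix and its
  -- orthogonal complement to matrices of trace zero.
  set v : E →ₗ[ℂ] Matrix (Fin 2) (Fin 2) ℂ := LinearMap.mulLeft ℂ (w x₁).adjugate ∘ₗ w with hv
  have hv_apply : ∀ y, v y = (w x₁).adjugate * w y := fun y => rfl
  have htr : ∀ y, inner ℂ x₁ y = 0 → (v y).trace = 0 := by
    intro y hy
    have h := horth₁ y hy
    rw [polarDet_apply] at h
    rw [hv_apply, Matrix.trace_fin_two]
    simp only [Matrix.adjugate_fin_two, Matrix.mul_apply, Fin.sum_univ_two,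
      Matrix.of_apply, Matrix.cons_val', Matrix.cons_val_zero, Matrix.cons_val_one,
      Matrix.cons_val_fin_one]
    linear_combination h
  have hscalar : ∀ T : Matrix (Fin 2) (Fin 2) ℂ,
      T.adjugate * v x₁ * T = ((w x₁).det * T.det) • 1 := by
    intro T
    rw [hv_apply, Matrix.adjugate_mul, Matrix.mul_smul, Matrix.mul_one, Matrix.smul_mul,
      Matrix.adjugate_mul, smul_smul]
  have hadj : ∀ T : Matrix (Fin 2) (Fin 2) ℂ, T.det ≠ 0 →
      (T.adjugate * (w x₁).adjugate).det ≠ 0 := by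
    intro T hT
    rw [Matrix.det_mul, Matrix.det_adjugate, Matrix.det_adjugate]
    simpa using ⟨hT, hx₁⟩
  have hassoc : ∀ (T : Matrix (Fin 2) (Fin 2) ℂ) (y : E),
      T.adjugate * (w x₁).adjugate * w y * T = T.adjugate * v y * T := by
    intro T y
    rw [hv_apply, ← mul_assoc]
  set F : Submodule ℂ E := (Submodule.span ℂ {x₁})ᗮ with hF
  have hmemF : ∀ y, y ∈ F ↔ inner ℂ x₁ y = 0 := fun y =>
    Submodule.mem_orthogonal_singleton_iff_inner_right
  by_cases hdet : ∃ y : F, ((v ∘ₗ F.subtype) y).det ≠ 0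
  · obtain ⟨x₂, hx₂, horth₂⟩ := exists_det_ne_zero_orthogonal _ hdet
    have hx₂tr := htr x₂ ((hmemF _).1 x₂.2)
    obtain ⟨T, hT, h01, h10⟩ := exists_adjugate_mul_mul_diagonal (v x₂) hx₂tr hx₂
    refine ⟨T.adjugate * (w x₁).adjugate, T, Submodule.span ℂ {x₁, (x₂ : E)}, hadj T hT, hT,
      ?_, ?_⟩
    · intro y hy
      obtain ⟨a, b, rfl⟩ := Submodule.mem_span_pair.1 hy
      rw [hassoc]
      have : T.adjugate * v (a • x₁ + b • (x₂ : E)) * T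
          = a • (((w x₁).det * T.det) • (1 : Matrix (Fin 2) (Fin 2) ℂ))
            + b • (T.adjugate * v x₂ * T) := by
        rw [map_add, map_smul, map_smul, ← hscalar T, Matrix.mul_add, Matrix.add_mul,
          Matrix.mul_smul, Matrix.mul_smul, Matrix.smul_mul, Matrix.smul_mul]
      rw [this]
      simp [h01, h10]
    · intro y hy
      rw [hassoc]
      have hy₁ : inner ℂ x₁ y = 0 := hy x₁ (Submodule.subset_span (by simp))
      have hy₂ : inner ℂ (x₂ : E) y = 0 := hy x₂ (Submodule.subset_span (by simp))
      have hp := horth₂ ⟨y, (hmemF y).2 hy₁⟩ hy₂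
      rw [polarDet_apply] at hp
      have hp' := polar_adjugate_mul_mul T (v x₂) (v y)
      have e1 := trace_adjugate_mul_mul T (v y)
      have e2 := trace_adjugate_mul_mul T (v x₂)
      have hd := det_adjugate_mul_mul T (v x₂)
      have hy0 := htr y hy₁
      rw [Matrix.trace_fin_two] at hy0 hx₂tr
      rw [hy0, mul_zero] at e1
      rw [hx₂tr, mul_zero] at e2
      have hp0 : v x₂ 0 0 * v y 1 1 + v x₂ 1 1 * v y 0 0 - v x₂ 0 1 * v y 1 0
        - v x₂ 1 0 * v y 0 1 = 0 := hp
      rw [hp0, h01, h10, mul_zero] at hp'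
      have hN : (T.adjugate * v x₂ * T) 0 0 ≠ 0 := by
        intro h0
        have h0' : (T.adjugate * v x₂ * T).det = 0 := by
          rw [Matrix.det_fin_two, h0, h01]; ring
        rw [hd] at h0'
        exact (mul_ne_zero (pow_ne_zero 2 hT) hx₂) h0'
      have hW : (T.adjugate * v x₂ * T) 0 0 * (T.adjugate * v y * T) 0 0 = 0 := by
        linear_combination (-1/2) * hp' + (1 / 2) * (T.adjugate * v x₂ * T) 0 0 * e1
          + (1 / 2) * (T.adjugate * v y * T) 0 0 * e2
      have hW0 := (mul_eq_zero.1 hW).resolve_left hN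
      exact ⟨hW0, by linear_combination e1 - hW0⟩
  · push Not at hdet
    have hdet' : ∀ y, inner ℂ x₁ y = 0 → (v y).det = 0 := fun y hy => hdet ⟨y, (hmemF y).2 hy⟩
    have hpolar : ∀ x y, inner ℂ x₁ x = 0 → inner ℂ x₁ y = 0 →
        v x 0 0 * v y 1 1 + v x 1 1 * v y 0 0 - v x 0 1 * v y 1 0 - v x 1 0 * v y 0 1 = 0 := by
      intro x y hx hy
      have h1 := hdet' (x + y) (by rw [inner_add_right, hx, hy, add_zero])
      have h2 := hdet' x hx
      have h3 := hdet' y hy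
      rw [Matrix.det_fin_two] at h1 h2 h3
      simp only [map_add, Matrix.add_apply] at h1
      linear_combination h1 - h2 - h3
    have hdiag : ∀ T : Matrix (Fin 2) (Fin 2) ℂ, ∀ y ∈ Submodule.span ℂ {x₁},
        (T.adjugate * v y * T) 0 1 = 0 ∧ (T.adjugate * v y * T) 1 0 = 0 := by
      intro T y hy
      obtain ⟨a, rfl⟩ := Submodule.mem_span_singleton.1 hy
      rw [map_smul, Matrix.mul_smul, Matrix.smul_mul, hscalar T]
      simp
    by_cases hz : ∃ x, inner ℂ x₁ x = 0 ∧ v x ≠ 0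
    · obtain ⟨x, hx, hvx⟩ := hz
      obtain ⟨T, hT, h00, h10, h11⟩ :=
        exists_adjugate_mul_mul_strictUpper (v x) (htr x hx) (hdet' x hx)
      refine ⟨T.adjugate * (w x₁).adjugate, T, Submodule.span ℂ {x₁}, hadj T hT, hT, ?_, ?_⟩
      · intro y hy
        rw [hassoc]
        exact hdiag T y hy
      · intro y hy
        rw [hassoc]
        have hy := (hmemF y).1 hy
        have h01 : (T.adjugate * v x * T) 0 1 ≠ 0 := by
          intro h01
          have hzero : T.adjugate * v x * T = 0 := by
            ext i j; fin_cases i <;> fin_cases j <;> simp [h00, h01, h10, h11]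
          have : T * (T.adjugate * v x * T) * T.adjugate = (T.det * T.det) • v x := by
            rw [Matrix.mul_assoc, Matrix.mul_assoc (T.adjugate * v x), Matrix.mul_adjugate,
              ← Matrix.mul_assoc, ← Matrix.mul_assoc, Matrix.mul_adjugate]
            simp [smul_smul]
          rw [hzero, Matrix.mul_zero, Matrix.zero_mul] at this
          exact (smul_ne_zero (mul_ne_zero hT hT) hvx) this.symm
        have hp := polar_adjugate_mul_mul T (v x) (v y)
        rw [hpolar x y hx hy, h00, h10, h11, mul_zero] at hp
        have hW10 : (T.adjugate * v y * T) 1 0 = 0 := by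
          have : (T.adjugate * v x * T) 0 1 * (T.adjugate * v y * T) 1 0 = 0 := by
            linear_combination -hp
          exact (mul_eq_zero.1 this).resolve_left h01
        have e1 := trace_adjugate_mul_mul T (v y)
        have hy0 := htr y hy
        rw [Matrix.trace_fin_two] at hy0
        rw [hy0, mul_zero] at e1
        have hd := det_adjugate_mul_mul T (v y)
        rw [hdet' y hy, Matrix.det_fin_two, hW10, mul_zero, mul_zero, sub_zero] at hd
        have hW0 : (T.adjugate * v y * T) 0 0 = 0 := by
          have : (T.adjugate * v y * T) 0 0 ^ 2 = 0 := by
            linear_combination (T.adjugate * v y * T) 0 0 * e1 - hd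
          exact (pow_eq_zero_iff (by norm_num)).1 this
        exact ⟨hW0, by linear_combination e1 - hW0⟩
    · push Not at hz
      refine ⟨(1 : Matrix (Fin 2) (Fin 2) ℂ).adjugate * (w x₁).adjugate, 1,
        Submodule.span ℂ {x₁}, hadj 1 (by simp), by simp, ?_, ?_⟩
      · intro y hy
        rw [hassoc]
        exact hdiag 1 y hy
      · intro y hy
        rw [hassoc, hz y ((hmemF y).1 hy)]
        simp

/-- Coordinate form of `exists_filter_diagonal_antidiagonal`. -/
theorem exists_filter_orthogonal {κ : Type*} [Fintype κ] (W : κ → Matrix (Fin 2) (Fin 2) ℂ) :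
    (∀ k, (W k).det = 0) ∨
    ∃ S T : Matrix (Fin 2) (Fin 2) ℂ, S.det ≠ 0 ∧ T.det ≠ 0 ∧
      ∀ a b c : Fin 2, b ≠ c →
        ∑ k, (S * W k * T) a b * star ((S * W k * T) a c) = 0 ∧
        ∑ k, (S * W k * T) b a * star ((S * W k * T) c a) = 0 := by
  classical
  let w : EuclideanSpace ℂ κ →ₗ[ℂ] Matrix (Fin 2) (Fin 2) ℂ :=
    { toFun := fun y => ∑ k, y k • W k
      map_add' := fun y z => by simp [add_smul, Finset.sum_add_distrib]
      map_smul' := fun c y => by simp [mul_smul, Finset.smul_sum] }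
  by_cases hne : ∃ x, (w x).det ≠ 0
  · right
    obtain ⟨S, T, U, hS, hT, h1, h2⟩ := exists_filter_diagonal_antidiagonal w hne
    refine ⟨S, T, hS, hT, ?_⟩
    let c : Fin 2 → Fin 2 → EuclideanSpace ℂ κ :=
      fun a b => WithLp.toLp 2 fun k => star ((S * W k * T) a b)
    have hc : ∀ a b y, inner ℂ (c a b) y = (S * w y * T) a b := by
      intro a b y
      have : S * w y * T = ∑ k, y k • (S * W k * T) := by
        change S * (∑ k, y k • W k) * T = _
        rw [Matrix.mul_sum, Matrix.sum_mul]
        simp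
      rw [this, PiLp.inner_apply, Matrix.sum_apply]
      simp [c]
    have hdiag : ∀ a, c a a ∈ U := by
      intro a
      rw [← Submodule.orthogonal_orthogonal U, Submodule.mem_orthogonal']
      intro y hy
      rw [hc]
      fin_cases a
      exacts [(h2 y hy).1, (h2 y hy).2]
    have hanti : ∀ a b, a ≠ b → c a b ∈ Uᗮ := by
      intro a b hab
      rw [Submodule.mem_orthogonal']
      intro y hy
      rw [hc]
      fin_cases a <;> fin_cases b
      exacts [(hab rfl).elim, (h1 y hy).1, (h1 y hy).2, (hab rfl).elim]
    have hinner : ∀ a b a' b', inner ℂ (c a b) (c a' b')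
        = ∑ k, (S * W k * T) a b * star ((S * W k * T) a' b') := by
      intro a b a' b'
      rw [PiLp.inner_apply]
      simp [c, mul_comm]
    have hzero : ∀ a b a' b', a = b → a' ≠ b' → inner ℂ (c a b) (c a' b') = 0 ∧
        inner ℂ (c a' b') (c a b) = 0 := by
      rintro a b a' b' rfl h
      exact ⟨hanti a' b' h _ (hdiag a) , by
        rw [← inner_conj_symm, hanti a' b' h _ (hdiag a), map_zero]⟩
    intro a b d hbd
    rw [← hinner, ← hinner]
    by_cases hab : a = b
    · exact ⟨(hzero _ _ _ _ hab (by rw [hab]; exact hbd)).1,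
        (hzero _ _ _ _ hab.symm (by rw [hab]; exact hbd.symm)).1⟩
    · have had : a = d := by omega
      exact ⟨(hzero _ _ _ _ had hab).2, (hzero _ _ _ _ had.symm (Ne.symm hab)).2⟩
  · left
    push Not at hne
    intro k
    have := hne (EuclideanSpace.single k 1)
    have hw : w (EuclideanSpace.single k 1) = W k := by
      change ∑ j, (EuclideanSpace.single k (1 : ℂ)) j • W j = W k
      simp
    rwa [hw] at this

end NormalForm

/-! ### Concurrence of vectors with a qubit and of X-states -/

section TwoQubits

open Matrix

theorem sum_mul_star_self {κ : Type*} [Fintype κ] (f : κ → ℂ) :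
    ∑ k, f k * star (f k) = ((∑ k, ‖f k‖ ^ 2 : ℝ) : ℂ) := by
  simp only [Complex.star_def, Complex.mul_conj, Complex.normSq_eq_norm_sq, Complex.ofReal_sum]

theorem norm_sum_mul_star_le {κ : Type*} [Fintype κ] (f g : κ → ℂ) :
    ‖∑ k, f k * star (g k)‖ ≤ √(∑ k, ‖f k‖ ^ 2) * √(∑ k, ‖g k‖ ^ 2) := by
  refine (norm_sum_le _ _).trans ?_
  simp only [norm_mul, norm_star]
  exact Real.sum_mul_le_sqrt_mul_sqrt _ _ _

theorem star_sum_mul_star {κ : Type*} [Fintype κ] (f g : κ → ℂ) :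
    star (∑ k, f k * star (g k)) = ∑ k, g k * star (f k) := by
  rw [star_sum]
  exact Finset.sum_congr rfl fun k _ => by rw [star_mul', star_star, mul_comm]

theorem vectorConcurrence_eq_det {κ : Type*} [Fintype κ] (φ : Fin 2 × κ → ℂ) :
    vectorConcurrence φ = 2 * √((traceSecond (pureState φ)).det.re) := by
  have h : ∀ a b, traceSecond (pureState φ) a b = ∑ k, φ (a, k) * star (φ (b, k)) :=
    fun a b => rfl
  unfold vectorConcurrence
  rw [Matrix.trace_fin_two, Matrix.mul_apply, Matrix.mul_apply, Matrix.det_fin_two,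
    Fin.sum_univ_two, Fin.sum_univ_two, Fintype.sum_prod_type, Fin.sum_univ_two, h, h, h, h,
    sum_mul_star_self, sum_mul_star_self]
  set p := ∑ k, ‖φ (0, k)‖ ^ 2
  set q := ∑ k, ‖φ (1, k)‖ ^ 2
  set z := (∑ k, φ (0, k) * star (φ (1, k))) * ∑ k, φ (1, k) * star (φ (0, k))
  rw [mul_comm (∑ k, φ (1, k) * star (φ (0, k)))]
  change √(2 * ((p + q) ^ 2 - ((p : ℂ) * p + z + (z + (q : ℂ) * q)).re)) = _
  have : 2 * ((p + q) ^ 2 - ((p : ℂ) * p + z + (z + (q : ℂ) * q)).re)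
      = 2 ^ 2 * ((p : ℂ) * q - z).re := by
    simp only [Complex.add_re, Complex.sub_re, ← Complex.ofReal_mul, Complex.ofReal_re]
    ring
  rw [this, Real.sqrt_mul (by positivity), Real.sqrt_sq (by norm_num)]

theorem det_traceSecond_pureState {κ : Type*} [Fintype κ] (φ : Fin 2 × κ → ℂ) :
    (traceSecond (pureState φ)).det.re = (∑ k, ‖φ (0, k)‖ ^ 2) * (∑ k, ‖φ (1, k)‖ ^ 2)
      - ‖∑ k, φ (0, k) * star (φ (1, k))‖ ^ 2 := by
  have h : ∀ a b, traceSecond (pureState φ) a b = ∑ k, φ (a, k) * star (φ (b, k)) :=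
    fun a b => rfl
  rw [Matrix.det_fin_two, h, h, h, h, sum_mul_star_self, sum_mul_star_self,
    ← star_sum_mul_star (fun k => φ (0, k)) (fun k => φ (1, k)), Complex.star_def,
    Complex.mul_conj, Complex.normSq_eq_norm_sq, ← Complex.ofReal_mul, ← Complex.ofReal_sub,
    Complex.ofReal_re]

theorem det_traceSecond_pureState_nonneg {κ : Type*} [Fintype κ] (φ : Fin 2 × κ → ℂ) :
    0 ≤ (traceSecond (pureState φ)).det.re := by
  rw [det_traceSecond_pureState, sub_nonneg]
  have h := norm_sum_mul_star_le (fun k => φ (0, k)) (fun k => φ (1, k))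
  calc _ ≤ (√(∑ k, ‖φ (0, k)‖ ^ 2) * √(∑ k, ‖φ (1, k)‖ ^ 2)) ^ 2 := by gcongr
    _ = _ := by
      rw [mul_pow, Real.sq_sqrt (by positivity), Real.sq_sqrt (by positivity)]

/-- The concurrence of a two-qubit vector, seen as a `2 × 2` matrix, is twice the modulus of its
determinant. -/
theorem vectorConcurrence_two_qubits (W : Matrix (Fin 2) (Fin 2) ℂ) :
    vectorConcurrence (fun x => W x.1 x.2) = 2 * ‖W.det‖ := by
  have h : traceSecond (pureState fun x => W x.1 x.2) = W * Wᴴ := by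
    ext a b
    simp [traceSecond, pureState_apply, Matrix.mul_apply]
  rw [vectorConcurrence_eq_det, h, Matrix.det_mul, Matrix.det_conjTranspose, Complex.star_def,
    Complex.mul_conj, Complex.ofReal_re, Complex.normSq_eq_norm_sq, Real.sqrt_sq (norm_nonneg _)]

theorem sum_pureState_mulVec {ι J J' : Type*} [Fintype ι] [Fintype J] [Fintype J']
    (L : Matrix ι ι ℂ) {f : J → ι → ℂ} {g : J' → ι → ℂ}
    (h : ∑ j, pureState (f j) = ∑ j, pureState (g j)) :
    ∑ j, pureState (L *ᵥ f j) = ∑ j, pureState (L *ᵥ g j) := by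
  have key : ∀ φ : ι → ℂ, pureState (L *ᵥ φ) = L * pureState φ * Lᴴ := by
    intro φ
    unfold pureState
    rw [Matrix.mul_vecMulVec, Matrix.vecMulVec_mul, Matrix.star_mulVec]
  simp only [key, ← Matrix.sum_mul, ← Matrix.mul_sum, h]

theorem sum_pureState_filter {J J' : Type*} [Fintype J] [Fintype J']
    (S T : Matrix (Fin 2) (Fin 2) ℂ) {f : J → Matrix (Fin 2) (Fin 2) ℂ}
    {g : J' → Matrix (Fin 2) (Fin 2) ℂ}
    (h : ∑ j, pureState (fun x : Fin 2 × Fin 2 => f j x.1 x.2)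
      = ∑ j, pureState (fun x : Fin 2 × Fin 2 => g j x.1 x.2)) :
    ∑ j, pureState (fun x : Fin 2 × Fin 2 => (S * f j * T) x.1 x.2)
      = ∑ j, pureState (fun x : Fin 2 × Fin 2 => (S * g j * T) x.1 x.2) := by
  have key : ∀ W : Matrix (Fin 2) (Fin 2) ℂ,
      (fun x : Fin 2 × Fin 2 => (S * W * T) x.1 x.2)
        = (Matrix.of fun x y : Fin 2 × Fin 2 => S x.1 y.1 * T y.2 x.2) *ᵥ
          fun x : Fin 2 × Fin 2 => W x.1 x.2 := by
    intro W
    ext x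
    simp only [Matrix.mulVec, dotProduct, Fintype.sum_prod_type, Matrix.mul_apply,
      Fin.sum_univ_two, Matrix.of_apply]
    ring
  simp only [key]
  exact sum_pureState_mulVec _ h

/-- A point of a disc is the midpoint of two points of its boundary circle. -/
theorem exists_midpoint_of_norm_le (z : ℂ) (r : ℝ) (h : ‖z‖ ≤ r) :
    ∃ ω : Fin 2 → ℂ, (∀ s, ‖ω s‖ = 1) ∧ z = r * ((ω 0 + ω 1) / 2) := by
  have hr : 0 ≤ r := (norm_nonneg z).trans h
  set θ := Complex.arg z
  set η := Real.arccos (‖z‖ / r)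
  refine ⟨![Complex.exp (((θ + η : ℝ) : ℂ) * Complex.I),
    Complex.exp (((θ - η : ℝ) : ℂ) * Complex.I)], ?_, ?_⟩
  · intro s
    fin_cases s <;> exact Complex.norm_exp_ofReal_mul_I _
  · have hcos : Complex.cos (η : ℂ) = ((‖z‖ / r : ℝ) : ℂ) := by
      rw [← Complex.ofReal_cos, Real.cos_arccos]
      · have : 0 ≤ ‖z‖ / r := by positivity
        linarith
      · exact div_le_one_of_le₀ h hr
    have hrz : (r : ℂ) * ((‖z‖ / r : ℝ) : ℂ) = ‖z‖ := by
      by_cases hr0 : r = 0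
      · have : ‖z‖ = 0 := le_antisymm (hr0 ▸ h) (norm_nonneg _)
        simp [this]
      · rw [← Complex.ofReal_mul, mul_div_cancel₀ _ hr0]
    have hsum : Complex.exp (((θ + η : ℝ) : ℂ) * Complex.I)
        + Complex.exp (((θ - η : ℝ) : ℂ) * Complex.I)
        = 2 * (Complex.cos η * Complex.exp (θ * Complex.I)) := by
      rw [Complex.cos]
      push_cast
      rw [add_mul, sub_mul, Complex.exp_add, sub_eq_add_neg, Complex.exp_add, ← neg_mul]
      ring
    simp only [Matrix.cons_val_zero, Matrix.cons_val_one]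
    rw [hsum, hcos, mul_div_cancel_left₀ _ two_ne_zero, ← mul_assoc, hrz]
    exact (Complex.norm_mul_exp_arg_mul_I z).symm

theorem exists_norm_one_sq_mul (ω ω' : ℂ) (h : ‖ω‖ = 1) (h' : ‖ω'‖ = 1) :
    ∃ κ : ℂ, ‖κ‖ = 1 ∧ κ ^ 2 * ω' = ω := by
  obtain ⟨κ, hκ⟩ := IsAlgClosed.exists_pow_nat_eq (ω / ω') (n := 2) (by norm_num)
  have h0 : ω' ≠ 0 := by rintro rfl; simp at h'
  refine ⟨κ, ?_, ?_⟩
  · have : ‖κ‖ ^ 2 = 1 := by rw [← norm_pow, hκ, norm_div, h, h', div_one]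
    exact (pow_eq_one_iff_of_nonneg (norm_nonneg _) two_ne_zero).1 this
  · rw [hκ, div_mul_cancel₀ _ h0]

/-- An unnormalized X-state has a decomposition into four vectors with equal concurrence.
Each of the two blocks of the state is the average of two vectors with entries of constant modulus,
and superposing a vector of one block with one of the other, in both signs and with
suitable phases, makes the two contributions to the determinant cancel as far as possible. -/
theorem exists_decomposition_of_orthogonal {κ : Type*} [Fintype κ]
    (V : κ → Matrix (Fin 2) (Fin 2) ℂ)
    (h : ∀ a b c : Fin 2, b ≠ c → ∑ k, V k a b * star (V k a c) = 0 ∧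
        ∑ k, V k b a * star (V k c a) = 0) :
    ∃ g : Fin 2 × Fin 2 → Matrix (Fin 2) (Fin 2) ℂ,
      ∑ k, pureState (fun x : Fin 2 × Fin 2 => V k x.1 x.2)
        = ∑ j, pureState (fun x : Fin 2 × Fin 2 => g j x.1 x.2) ∧
      ∀ j, ‖(g j).det‖ = |√(∑ k, ‖V k 0 0‖ ^ 2) * √(∑ k, ‖V k 1 1‖ ^ 2)
        - √(∑ k, ‖V k 0 1‖ ^ 2) * √(∑ k, ‖V k 1 0‖ ^ 2)| / 4 := by
  set P := fun a b => √(∑ k, ‖V k a b‖ ^ 2) with hP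
  have hPP : ∀ a b, (P a b : ℂ) * P a b = ∑ k, V k a b * star (V k a b) := by
    intro a b
    rw [sum_mul_star_self, ← Complex.ofReal_mul, Real.mul_self_sqrt (by positivity)]
  obtain ⟨ω, hω, hx⟩ := exists_midpoint_of_norm_le _ _
    (norm_sum_mul_star_le (fun k => V k 1 1) (fun k => V k 0 0))
  obtain ⟨ω', hω', hy⟩ := exists_midpoint_of_norm_le _ _
    (norm_sum_mul_star_le (fun k => V k 1 0) (fun k => V k 0 1))
  choose c hc hcω using fun s => exists_norm_one_sq_mul (ω s) (ω' s) (hω s) (hω' s)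
  change _ = ((P 1 1 * P 0 0 : ℝ) : ℂ) * _ at hx
  change _ = ((P 1 0 * P 0 1 : ℝ) : ℂ) * _ at hy
  have hunit : ∀ z : ℂ, ‖z‖ = 1 → z * star z = 1 := by
    intro z hz
    rw [Complex.star_def, Complex.mul_conj, Complex.normSq_eq_norm_sq, hz]; norm_num
  have hx' := congrArg star hx
  have hy' := congrArg star hy
  rw [star_sum_mul_star] at hx' hy'
  simp only [Complex.star_def, map_mul, map_add, map_div₀, Complex.conj_ofReal, map_ofNat,
    Complex.ofReal_mul] at hx hy hx' hy'
  have u0 := hunit _ (hω 0)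
  have u1 := hunit _ (hω 1)
  have v0 := hunit _ (hω' 0)
  have v1 := hunit _ (hω' 1)
  have c0 := hunit _ (hc 0)
  have c1 := hunit _ (hc 1)
  simp only [Complex.star_def] at u0 u1 v0 v1 c0 c1 hPP h
  let ε : Fin 2 → ℂ := ![1, -1]
  have hε0 : ε 0 = 1 := rfl
  have hε1 : ε 1 = -1 := rfl
  refine ⟨fun j => !![(P 0 0 : ℂ) / 2, ε j.2 * c j.1 * P 0 1 / 2;
      ε j.2 * c j.1 * ω' j.1 * P 1 0 / 2, ω j.1 * P 1 1 / 2], ?_, ?_⟩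
  · have e00 := hPP 0 0
    have e01 := hPP 0 1
    have e10 := hPP 1 0
    have e11 := hPP 1 1
    ext ⟨a, b⟩ ⟨a', b'⟩
    simp only [Matrix.sum_apply, pureState_apply, Fintype.sum_prod_type, Fin.sum_univ_two,
      Complex.star_def, hε0, hε1]
    fin_cases a <;> fin_cases b <;> fin_cases a' <;> fin_cases b' <;>
      simp only [Fin.zero_eta, Fin.mk_one, Fin.isValue, Matrix.of_apply, Matrix.cons_val',
        Matrix.cons_val_zero, Matrix.cons_val_one, Matrix.cons_val_fin_one, map_mul, map_div₀,
        map_neg, map_one, map_ofNat, Complex.conj_ofReal]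
    · rw [← e00]; ring
    · rw [(h 0 0 1 (by decide)).1]; ring
    · rw [(h 0 0 1 (by decide)).2]; ring
    · rw [hx']; ring
    · rw [(h 0 1 0 (by decide)).1]; ring
    · rw [← e01]
      linear_combination (-(P 0 1 : ℂ) * P 0 1 / 2) * (c0 + c1)
    · rw [hy']
      linear_combination (-(P 0 1 : ℂ) * P 1 0 / 2) * (starRingEnd ℂ (ω' 0) * c0
        + starRingEnd ℂ (ω' 1) * c1)
    · rw [(h 1 0 1 (by decide)).2]; ring
    · rw [(h 0 1 0 (by decide)).2]; ring
    · rw [hy]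
      linear_combination (-(P 0 1 : ℂ) * P 1 0 / 2) * (ω' 0 * c0 + ω' 1 * c1)
    · rw [← e10]
      linear_combination (-(P 1 0 : ℂ) * P 1 0 / 2) *
        (ω' 0 * starRingEnd ℂ (ω' 0) * c0 + v0 + ω' 1 * starRingEnd ℂ (ω' 1) * c1 + v1)
    · rw [(h 1 0 1 (by decide)).1]; ring
    · rw [hx]; ring
    · rw [(h 1 1 0 (by decide)).2]; ring
    · rw [(h 1 1 0 (by decide)).1]; ring
    · rw [← e11]
      linear_combination (-(P 1 1 : ℂ) * P 1 1 / 2) * (u0 + u1)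
  · intro j
    have hεsq : ε j.2 ^ 2 = 1 := by
      obtain ⟨s, t⟩ := j
      fin_cases t
      · change (1 : ℂ) ^ 2 = 1; norm_num
      · change (-1 : ℂ) ^ 2 = 1; norm_num
    have : (P 0 0 : ℂ) / 2 * (ω j.1 * P 1 1 / 2)
        - ε j.2 * c j.1 * P 0 1 / 2 * (ε j.2 * c j.1 * ω' j.1 * P 1 0 / 2)
        = ω j.1 * (((P 0 0 * P 1 1 - P 0 1 * P 1 0) / 4 : ℝ) : ℂ) := by
      push_cast
      linear_combination (-(P 0 1 : ℂ) * P 1 0 / 4) * (c j.1 ^ 2 * ω' j.1 * hεsq + hcω j.1)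
    rw [Matrix.det_fin_two_of, this, norm_mul, hω, one_mul, Complex.norm_real, Real.norm_eq_abs,
      abs_div, abs_of_pos (by norm_num : (0 : ℝ) < 4)]

/-- If local filters `S` and `T` turn a two-qubit state into an X-state, the decomposition of the
X-state is pulled back along the filters, which rescales each determinant by `(det S * det T)⁻¹`. -/
theorem concurrence_le_of_filter {κ : Type*} [Fintype κ]
    {ρ : Matrix (Fin 2 × Fin 2) (Fin 2 × Fin 2) ℂ}
    (htr : ρ.trace = 1) (W : κ → Matrix (Fin 2) (Fin 2) ℂ)
    (hρ : ρ = ∑ k, pureState (fun x : Fin 2 × Fin 2 => W k x.1 x.2))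
    {S T : Matrix (Fin 2) (Fin 2) ℂ} (hS : S.det ≠ 0) (hT : T.det ≠ 0)
    (h : ∀ a b c : Fin 2, b ≠ c →
        ∑ k, (S * W k * T) a b * star ((S * W k * T) a c) = 0 ∧
        ∑ k, (S * W k * T) b a * star ((S * W k * T) c a) = 0) :
    concurrence ρ ≤ 2 * |√(∑ k, ‖(S * W k * T) 0 0‖ ^ 2) * √(∑ k, ‖(S * W k * T) 1 1‖ ^ 2)
        - √(∑ k, ‖(S * W k * T) 0 1‖ ^ 2) * √(∑ k, ‖(S * W k * T) 1 0‖ ^ 2)|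
          / (‖S.det‖ * ‖T.det‖) := by
  obtain ⟨g, hg, hdet⟩ := exists_decomposition_of_orthogonal (fun k => S * W k * T) h
  have hdec := sum_pureState_filter S⁻¹ T⁻¹ hg
  have hback : ∀ k, S⁻¹ * (S * W k * T) * T⁻¹ = W k := by
    intro k
    rw [Matrix.mul_assoc S, Matrix.nonsing_inv_mul_cancel_left _ _ (isUnit_iff_ne_zero.2 hS),
      Matrix.mul_nonsing_inv_cancel_right _ _ (isUnit_iff_ne_zero.2 hT)]
  simp only [hback] at hdec
  refine (concurrence_le_sum_vectorConcurrence htr _ (hρ.trans hdec)).trans_eq ?_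
  simp only [vectorConcurrence_two_qubits, Matrix.det_mul, norm_mul, hdet,
    Matrix.det_nonsing_inv, Ring.inverse_eq_inv', norm_inv, Finset.sum_const, Finset.card_univ,
    Fintype.card_prod, Fintype.card_fin, nsmul_eq_mul]
  have := norm_ne_zero_iff.2 hS
  have := norm_ne_zero_iff.2 hT
  field_simp
  norm_num
  ring

end TwoQubits

/-! ### Monogamy for pure states -/

/-- The partial trace over the third factor of a tripartite system. -/
def traceLast {ι κ τ : Type*} [Fintype τ] (ρ : Matrix (ι × κ × τ) (ι × κ × τ) ℂ) :
    Matrix (ι × κ) (ι × κ) ℂ :=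
  Matrix.of fun u v => ∑ c, ρ (u.1, u.2, c) (v.1, v.2, c)

/-- The partial trace over the second factor of a tripartite system. -/
def traceMiddle {ι κ τ : Type*} [Fintype κ] (ρ : Matrix (ι × κ × τ) (ι × κ × τ) ℂ) :
    Matrix (ι × τ) (ι × τ) ℂ :=
  Matrix.of fun u v => ∑ b, ρ (u.1, b, u.2) (v.1, b, v.2)

section PureMonogamy

open Matrix

theorem trace_traceLast {ι κ τ : Type*} [Fintype ι] [Fintype κ] [Fintype τ]
    (ρ : Matrix (ι × κ × τ) (ι × κ × τ) ℂ) : (traceLast ρ).trace = ρ.trace := by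
  simp [Matrix.trace, traceLast, Fintype.sum_prod_type]

theorem trace_traceMiddle {ι κ τ : Type*} [Fintype ι] [Fintype κ] [Fintype τ]
    (ρ : Matrix (ι × κ × τ) (ι × κ × τ) ℂ) : (traceMiddle ρ).trace = ρ.trace := by
  simp only [Matrix.trace, traceMiddle, Fintype.sum_prod_type, Matrix.diag_apply, Matrix.of_apply]
  exact Finset.sum_congr rfl fun _ _ => Finset.sum_comm

theorem det_smul_add_smul_re (P Q : Matrix (Fin 2) (Fin 2) ℂ) (s t : ℝ) :
    ((s : ℂ) • P + (t : ℂ) • Q).det.re = s ^ 2 * P.det.re + t ^ 2 * Q.det.re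
      + s * t * ((P + Q).det.re - P.det.re - Q.det.re) := by
  have : ((s : ℂ) • P + (t : ℂ) • Q).det = ((s ^ 2 : ℝ) : ℂ) * P.det + ((t ^ 2 : ℝ) : ℂ) * Q.det
      + ((s * t : ℝ) : ℂ) * ((P + Q).det - P.det - Q.det) := by
    simp only [Matrix.det_fin_two, Matrix.add_apply, Matrix.smul_apply, smul_eq_mul]
    push_cast
    ring
  rw [this]
  simp only [Complex.add_re, Complex.re_ofReal_mul, Complex.sub_re]

variable {κ : Type*} [Fintype κ]

/-- Measuring the qubit `B` of a pure state of `ABC`, with `A` a qubit, in an orthonormal basis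
bounds the concurrence of `AC`. The basis is the eigenbasis of an indefinite Hermitian matrix `Z`,
and the arithmetic-geometric mean inequality for its two eigenvalues gives the bound. -/
theorem concurrence_traceMiddle_sq_le {ψ : Fin 2 × Fin 2 × κ → ℂ} (hψ : IsStateVector ψ)
    (W : κ → Matrix (Fin 2) (Fin 2) ℂ) (hW : ∀ k a b, W k a b = ψ (a, b, k))
    {Z : Matrix (Fin 2) (Fin 2) ℂ} (hZ : Z.IsHermitian) (hdet : Z.det.re < 0) :
    concurrence (traceMiddle (pureState ψ)) ^ 2 ≤ vectorConcurrence ψ ^ 2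
      + 4 * ((∑ k, W k * Z * (W k)ᴴ).det.re / (-Z.det.re)) := by
  obtain ⟨U, ζ, hU, hZU⟩ : ∃ (U : Matrix (Fin 2) (Fin 2) ℂ) (ζ : Fin 2 → ℝ), U * Uᴴ = 1 ∧
      Z = U * diagonal (fun i => (ζ i : ℂ)) * Uᴴ := by
    refine ⟨hZ.eigenvectorUnitary, hZ.eigenvalues, ?_, ?_⟩
    · exact Matrix.mem_unitaryGroup_iff.1 hZ.eigenvectorUnitary.2
    · conv_lhs => rw [hZ.spectral_theorem, Unitary.conjStarAlgAut_apply]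
      rfl
  have hgen : ∀ (k k' : κ) (ξ : Fin 2 → ℂ) (a a' : Fin 2),
      (W k * (U * diagonal ξ * Uᴴ) * (W k')ᴴ) a a'
        = ∑ b, ξ b * ((W k * U) a b * star ((W k' * U) a' b)) := by
    intro k k' ξ a a'
    have : W k * (U * diagonal ξ * Uᴴ) * (W k')ᴴ = (W k * U) * diagonal ξ * (W k' * U)ᴴ := by
      rw [Matrix.conjTranspose_mul]
      simp only [Matrix.mul_assoc]
    rw [this, Matrix.mul_apply]
    refine Finset.sum_congr rfl fun b _ => ?_
    rw [Matrix.mul_diagonal, Matrix.conjTranspose_apply]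
    ring
  have hone : U * diagonal (fun _ => (1 : ℂ)) * Uᴴ = 1 := by
    rw [Matrix.diagonal_one, Matrix.mul_one, hU]
  set φ : Fin 2 → Fin 2 × κ → ℂ := fun b x => (W x.2 * U) x.1 b with hφ
  set P : Fin 2 → Matrix (Fin 2) (Fin 2) ℂ := fun b => traceSecond (pureState (φ b)) with hP
  have hX : ∑ k, W k * Z * (W k)ᴴ = (ζ 0 : ℂ) • P 0 + (ζ 1 : ℂ) • P 1 := by
    ext a a'
    rw [Matrix.sum_apply, hZU]
    simp only [hgen, Fin.sum_univ_two, Finset.sum_add_distrib, ← Finset.mul_sum]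
    rfl
  have hsum : traceSecond (pureState ψ) = P 0 + P 1 := by
    ext a a'
    have h1 : (∑ k, W k * (U * diagonal (fun _ => (1 : ℂ)) * Uᴴ) * (W k)ᴴ :
        Matrix (Fin 2) (Fin 2) ℂ) a a'
        = (P 0 + P 1) a a' := by
      rw [Matrix.sum_apply]
      simp only [hgen, Fin.sum_univ_two, Finset.sum_add_distrib, one_mul]
      rfl
    rw [← h1, hone, Matrix.sum_apply]
    simp only [Matrix.mul_one, Matrix.mul_apply, Matrix.conjTranspose_apply, hW]
    simp only [traceSecond, Matrix.of_apply, pureState_apply, Fintype.sum_prod_type]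
    exact Finset.sum_comm
  have hmid : traceMiddle (pureState ψ) = ∑ b, pureState (φ b) := by
    ext ⟨a, k⟩ ⟨a', k'⟩
    have h1 := hgen k k' (fun _ => 1) a a'
    rw [hone, Matrix.mul_one, Matrix.mul_apply] at h1
    simp only [Matrix.conjTranspose_apply, hW, one_mul] at h1
    rw [Matrix.sum_apply]
    exact h1
  have htr : (traceMiddle (pureState ψ)).trace = 1 := by
    rw [trace_traceMiddle, trace_pureState, show ∑ x, ‖ψ x‖ ^ 2 = 1 from hψ, Complex.ofReal_one]
  have hle := concurrence_le_sum_vectorConcurrence htr φ hmid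
  have hdetZ : Z.det.re = ζ 0 * ζ 1 := by
    have hUdet : U.det * Uᴴ.det = 1 := by rw [← Matrix.det_mul, hU, Matrix.det_one]
    have : Z.det = ((ζ 0 * ζ 1 : ℝ) : ℂ) := by
      rw [hZU, Matrix.det_mul, Matrix.det_mul, Matrix.det_diagonal, Fin.prod_univ_two,
        Complex.ofReal_mul]
      linear_combination ((ζ 0 : ℂ) * ζ 1) * hUdet
    rw [this, Complex.ofReal_re]
  simp only [Fin.sum_univ_two, vectorConcurrence_eq_det] at hle
  change _ ≤ 2 * √((P 0).det.re) + 2 * √((P 1).det.re) at hle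
  have hd0 : 0 ≤ (P 0).det.re := det_traceSecond_pureState_nonneg _
  have hd1 : 0 ≤ (P 1).det.re := det_traceSecond_pureState_nonneg _
  have hd : 0 ≤ (traceSecond (pureState ψ)).det.re := det_traceSecond_pureState_nonneg _
  rw [vectorConcurrence_eq_det, mul_pow, Real.sq_sqrt hd, hX, det_smul_add_smul_re, ← hsum]
  set d := (traceSecond (pureState ψ)).det.re
  have e0 := Real.sq_sqrt hd0
  have e1 := Real.sq_sqrt hd1
  have n0 := Real.sqrt_nonneg (P 0).det.re
  have n1 := Real.sqrt_nonneg (P 1).det.re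
  set s := √((P 0).det.re)
  set t := √((P 1).det.re)
  rw [← e0, ← e1, hdetZ]
  have hz : 0 < -(ζ 0 * ζ 1) := by rw [hdetZ] at hdet; linarith
  have h1 : concurrence (traceMiddle (pureState ψ)) ^ 2 ≤ (2 * s + 2 * t) ^ 2 :=
    pow_le_pow_left₀ (concurrence_nonneg _) hle 2
  have h2 : (s + t) ^ 2 - d ≤ (ζ 0 ^ 2 * s ^ 2 + ζ 1 ^ 2 * t ^ 2
      + ζ 0 * ζ 1 * (d - s ^ 2 - t ^ 2)) / (-(ζ 0 * ζ 1)) := by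
    rw [le_div_iff₀ hz]
    nlinarith [sq_nonneg (ζ 0 * s + ζ 1 * t)]
  nlinarith

/-- For a pure state of `ABC` with qubits `A` and `B`, the concurrence of `AC` is at most that
between `A` and `BC`. -/
theorem concurrence_traceMiddle_sq_le_vectorConcurrence_sq {ψ : Fin 2 × Fin 2 × κ → ℂ}
    (hψ : IsStateVector ψ) :
    concurrence (traceMiddle (pureState ψ)) ^ 2 ≤ vectorConcurrence ψ ^ 2 := by
  set φ : Fin 2 → Fin 2 × κ → ℂ := fun b x => ψ (x.1, b, x.2) with hφ
  have hmid : traceMiddle (pureState ψ) = ∑ b, pureState (φ b) := by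
    ext ⟨a, k⟩ ⟨a', k'⟩
    rw [Matrix.sum_apply]
    rfl
  have htr : (traceMiddle (pureState ψ)).trace = 1 := by
    rw [trace_traceMiddle, trace_pureState, show ∑ x, ‖ψ x‖ ^ 2 = 1 from hψ, Complex.ofReal_one]
  have hle := concurrence_le_sum_vectorConcurrence htr φ hmid
  simp only [Fin.sum_univ_two, vectorConcurrence_eq_det] at hle
  have h1 := pow_le_pow_left₀ (concurrence_nonneg _) hle 2
  refine h1.trans ?_
  have hd0 := det_traceSecond_pureState_nonneg (φ 0)
  have hd1 := det_traceSecond_pureState_nonneg (φ 1)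
  rw [vectorConcurrence_eq_det, mul_pow 2, Real.sq_sqrt (det_traceSecond_pureState_nonneg ψ),
    ← mul_add, mul_pow, add_sq, Real.sq_sqrt hd0, Real.sq_sqrt hd1]
  rw [det_traceSecond_pureState] at hd0 hd1
  have hψ0 : ∀ a : Fin 2, ∑ k, ‖ψ (a, k)‖ ^ 2 = ∑ k, ‖φ 0 (a, k)‖ ^ 2 + ∑ k, ‖φ 1 (a, k)‖ ^ 2 := by
    intro a
    rw [Fintype.sum_prod_type, Fin.sum_univ_two]
  have hψ1 : ∑ k, ψ (0, k) * star (ψ (1, k)) = ∑ k, φ 0 (0, k) * star (φ 0 (1, k))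
      + ∑ k, φ 1 (0, k) * star (φ 1 (1, k)) := by
    rw [Fintype.sum_prod_type, Fin.sum_univ_two]
  rw [det_traceSecond_pureState, det_traceSecond_pureState, det_traceSecond_pureState, hψ0, hψ0,
    hψ1]
  have hγ := norm_add_le (∑ k, φ 0 (0, k) * star (φ 0 (1, k)))
    (∑ k, φ 1 (0, k) * star (φ 1 (1, k)))
  have nγ := norm_nonneg (∑ k, φ 0 (0, k) * star (φ 0 (1, k)) +
    ∑ k, φ 1 (0, k) * star (φ 1 (1, k)))
  have nx := norm_nonneg (∑ k, φ 0 (0, k) * star (φ 0 (1, k)))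
  have ny := norm_nonneg (∑ k, φ 1 (0, k) * star (φ 1 (1, k)))
  have na : 0 ≤ ∑ k, ‖φ 0 (0, k)‖ ^ 2 := by positivity
  have nb : 0 ≤ ∑ k, ‖φ 0 (1, k)‖ ^ 2 := by positivity
  have na' : 0 ≤ ∑ k, ‖φ 1 (0, k)‖ ^ 2 := by positivity
  have nb' : 0 ≤ ∑ k, ‖φ 1 (1, k)‖ ^ 2 := by positivity
  generalize ∑ k, ‖φ 0 (0, k)‖ ^ 2 = a at *
  generalize ∑ k, ‖φ 0 (1, k)‖ ^ 2 = b at *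
  generalize ∑ k, ‖φ 1 (0, k)‖ ^ 2 = a' at *
  generalize ∑ k, ‖φ 1 (1, k)‖ ^ 2 = b' at *
  generalize ‖∑ k, φ 0 (0, k) * star (φ 0 (1, k)) +
    ∑ k, φ 1 (0, k) * star (φ 1 (1, k))‖ = γ at *
  generalize ‖∑ k, φ 0 (0, k) * star (φ 0 (1, k))‖ = x at *
  generalize ‖∑ k, φ 1 (0, k) * star (φ 1 (1, k))‖ = y at *
  have hs := Real.sq_sqrt (mul_nonneg na nb)
  have hs' := Real.sq_sqrt (mul_nonneg na' nb')
  have ns := Real.sqrt_nonneg (a * b)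
  have ns' := Real.sqrt_nonneg (a' * b')
  set s := √(a * b)
  set s' := √(a' * b')
  have hxs : x ≤ s := abs_le_of_sq_le_sq' (by linarith) ns |>.2
  have hys : y ≤ s' := abs_le_of_sq_le_sq' (by linarith) ns' |>.2
  have hprod : √(a * b - x ^ 2) * √(a' * b' - y ^ 2) ≤ s * s' - x * y := by
    rw [← Real.sqrt_mul hd0]
    refine Real.sqrt_le_iff.2 ⟨by nlinarith [mul_le_mul hxs hys ny ns], ?_⟩
    rw [← hs, ← hs']
    nlinarith [sq_nonneg (s * y - s' * x)]
  have hcross : 2 * (s * s') ≤ a * b' + a' * b := by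
    refine abs_le_of_sq_le_sq' ?_ (by positivity) |>.2
    calc (2 * (s * s')) ^ 2 = 4 * (s ^ 2 * s' ^ 2) := by ring
      _ = 4 * ((a * b) * (a' * b')) := by rw [hs, hs']
      _ ≤ _ := by nlinarith [sq_nonneg (a * b' - a' * b)]
  have hγ2 : γ ^ 2 ≤ (x + y) ^ 2 := pow_le_pow_left₀ nγ hγ 2
  nlinarith

/-- The arithmetic-geometric mean bound is attained up to `ε`; for `a = 0` or `b = 0` it is only
approached as `t` tends to `0` or to infinity. -/
theorem exists_div_add_mul_le {a b ε : ℝ} (ha : 0 ≤ a) (hb : 0 ≤ b) (hε : 0 < ε) :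
    ∃ t : ℝ, 0 < t ∧ a / t + t * b ≤ 2 * (√a * √b) + ε := by
  have hcont : Filter.Tendsto (fun δ : ℝ => 2 * ((√a + δ) * (√b + δ))) (nhdsWithin 0 (Set.Ioi 0))
      (nhds (2 * ((√a + 0) * (√b + 0)))) :=
    (Continuous.tendsto (by fun_prop) 0).mono_left nhdsWithin_le_nhds
  rw [add_zero, add_zero] at hcont
  obtain ⟨δ, hδ, hδ0⟩ := ((hcont.eventually_lt_const
    (show 2 * (√a * √b) < 2 * (√a * √b) + ε by linarith)).and self_mem_nhdsWithin).exists
  have hδ0 : 0 < δ := hδ0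
  have h1 := Real.sqrt_nonneg a
  have h2 := Real.sqrt_nonneg b
  refine ⟨(√a + δ) / (√b + δ), by positivity, le_trans ?_ hδ.le⟩
  have h3 : a / ((√a + δ) / (√b + δ)) ≤ (√a + δ) * (√b + δ) := by
    rw [div_div_eq_mul_div, div_le_iff₀ (by positivity)]
    have : a ≤ (√a + δ) * (√a + δ) := by nlinarith [Real.sq_sqrt ha, mul_nonneg h1 hδ0.le]
    nlinarith [mul_le_mul_of_nonneg_left this (show 0 ≤ √b + δ by positivity)]
  have h4 : (√a + δ) / (√b + δ) * b ≤ (√a + δ) * (√b + δ) := by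
    rw [div_mul_eq_mul_div, div_le_iff₀ (by positivity)]
    have : b ≤ (√b + δ) * (√b + δ) := by nlinarith [Real.sq_sqrt hb, mul_nonneg h2 hδ0.le]
    nlinarith [mul_le_mul_of_nonneg_left this (show 0 ≤ √a + δ by positivity)]
  linarith

/-- Monogamy of the squared concurrence for pure states of two qubits and a third system of
arbitrary finite dimension. -/
theorem concurrence_monogamy_pure {ψ : Fin 2 × Fin 2 × κ → ℂ} (hψ : IsStateVector ψ) :
    concurrence (traceLast (pureState ψ)) ^ 2 + concurrence (traceMiddle (pureState ψ)) ^ 2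
      ≤ pureConcurrence ψ ^ 2 := by
  rw [pureConcurrence_eq_vectorConcurrence hψ]
  set W : κ → Matrix (Fin 2) (Fin 2) ℂ := fun k => Matrix.of fun a b => ψ (a, b, k) with hW
  have htr : (traceLast (pureState ψ)).trace = 1 := by
    rw [trace_traceLast, trace_pureState, show ∑ x, ‖ψ x‖ ^ 2 = 1 from hψ, Complex.ofReal_one]
  have hlast : traceLast (pureState ψ)
      = ∑ k, pureState (fun x : Fin 2 × Fin 2 => W k x.1 x.2) := by
    ext u v
    rw [Matrix.sum_apply]
    rfl
  -- If all `W k` are singular, `AB` has an ensemble of product vectors.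
  rcases exists_filter_orthogonal W with h0 | ⟨S, T, hS, hT, horth⟩
  · have hle := concurrence_le_sum_vectorConcurrence htr _ hlast
    simp only [vectorConcurrence_two_qubits, h0, norm_zero, mul_zero, Finset.sum_const_zero]
      at hle
    rw [le_antisymm hle (concurrence_nonneg _)]
    simpa using concurrence_traceMiddle_sq_le_vectorConcurrence_sq hψ
  have hAB := concurrence_le_of_filter htr W hlast hS hT horth
  have hS0 := norm_pos_iff.2 hS
  have hT0 := norm_pos_iff.2 hT
  refine le_of_forall_pos_le_add fun ε hε => ?_
  set N := ‖S.det‖ * ‖T.det‖ with hN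
  have hN0 : 0 < N := mul_pos hS0 hT0
  set p := ∑ k, ‖(S * W k * T) 0 0‖ ^ 2 with hp
  set q := ∑ k, ‖(S * W k * T) 1 1‖ ^ 2 with hq
  set u := ∑ k, ‖(S * W k * T) 0 1‖ ^ 2 with hu
  set v := ∑ k, ‖(S * W k * T) 1 0‖ ^ 2 with hv
  have hp0 : 0 ≤ p := by positivity
  have hq0 : 0 ≤ q := by positivity
  have hu0 : 0 ≤ u := by positivity
  have hv0 : 0 ≤ v := by positivity
  obtain ⟨t, ht, hbound⟩ := exists_div_add_mul_le (mul_nonneg hp0 hv0) (mul_nonneg hu0 hq0)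
    (show 0 < ε * N ^ 2 / 4 by positivity)
  -- The Hermitian matrix that is `diag (1, -t)` in the filtered basis of `B`.
  set Z : Matrix (Fin 2) (Fin 2) ℂ := T * diagonal ![1, ((-t : ℝ) : ℂ)] * Tᴴ with hZ
  have hZherm : Z.IsHermitian := by
    refine Matrix.isHermitian_mul_mul_conjTranspose _
      (Matrix.isHermitian_diagonal_of_self_adjoint _ ?_)
    rw [isSelfAdjoint_iff]
    ext i
    fin_cases i <;> simp
  have hZdet : Z.det.re = -(t * ‖T.det‖ ^ 2) := by
    have : Z.det = ((-(t * ‖T.det‖ ^ 2) : ℝ) : ℂ) := by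
      rw [hZ, Matrix.det_mul, Matrix.det_mul, Matrix.det_conjTranspose, Matrix.det_diagonal,
        Fin.prod_univ_two, mul_right_comm, Complex.star_def, Complex.mul_conj,
        Complex.normSq_eq_norm_sq]
      simp
      ring
    rw [this, Complex.ofReal_re]
  have hXdet : ‖S.det‖ ^ 2 * (∑ k, W k * Z * (W k)ᴴ).det.re = (p - t * u) * (v - t * q) := by
    have hX : S * (∑ k, W k * Z * (W k)ᴴ) * Sᴴ
        = !![((p - t * u : ℝ) : ℂ), 0; 0, ((v - t * q : ℝ) : ℂ)] := by
      have h1 : S * (∑ k, W k * Z * (W k)ᴴ) * Sᴴ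
          = ∑ k, (S * W k * T) * diagonal ![1, ((-t : ℝ) : ℂ)] * (S * W k * T)ᴴ := by
        rw [Matrix.mul_sum, Matrix.sum_mul]
        refine Finset.sum_congr rfl fun k _ => ?_
        rw [hZ]
        simp only [Matrix.conjTranspose_mul, Matrix.mul_assoc]
      have h2 : ∀ a a', (S * (∑ k, W k * Z * (W k)ᴴ) * Sᴴ) a a'
          = ∑ k, (S * W k * T) a 0 * star ((S * W k * T) a' 0)
            - t * ∑ k, (S * W k * T) a 1 * star ((S * W k * T) a' 1) := by
        intro a a'
        rw [h1, Matrix.sum_apply, Finset.mul_sum, ← Finset.sum_sub_distrib]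
        refine Finset.sum_congr rfl fun k _ => ?_
        rw [Matrix.mul_apply, Fin.sum_univ_two, Matrix.mul_diagonal, Matrix.mul_diagonal,
          Matrix.conjTranspose_apply, Matrix.conjTranspose_apply]
        simp only [Matrix.cons_val_zero, Matrix.cons_val_one]
        push_cast
        ring
      ext a a'
      rw [h2]
      fin_cases a <;> fin_cases a'
      · change _ = ((p - t * u : ℝ) : ℂ)
        push_cast
        rw [hp, hu, ← sum_mul_star_self, ← sum_mul_star_self]
      · change _ = (0 : ℂ)
        rw [show (⟨0, by norm_num⟩ : Fin 2) = 0 from rfl,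
          show (⟨1, by norm_num⟩ : Fin 2) = 1 from rfl, (horth 0 0 1 (by decide)).2,
          (horth 1 0 1 (by decide)).2, mul_zero, sub_zero]
      · change _ = (0 : ℂ)
        rw [show (⟨0, by norm_num⟩ : Fin 2) = 0 from rfl,
          show (⟨1, by norm_num⟩ : Fin 2) = 1 from rfl, (horth 0 1 0 (by decide)).2,
          (horth 1 1 0 (by decide)).2, mul_zero, sub_zero]
      · change _ = ((v - t * q : ℝ) : ℂ)
        push_cast
        rw [hv, hq, ← sum_mul_star_self, ← sum_mul_star_self]
    have hdet := congrArg (fun M => (Matrix.det M).re) hX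
    simp only [Matrix.det_fin_two_of, mul_zero, sub_zero, ← Complex.ofReal_mul,
      Complex.ofReal_re] at hdet
    rw [Matrix.det_mul, Matrix.det_mul, mul_right_comm, Matrix.det_conjTranspose,
      Complex.star_def, Complex.mul_conj, Complex.normSq_eq_norm_sq, Complex.re_ofReal_mul] at hdet
    exact hdet
  have hAC := concurrence_traceMiddle_sq_le hψ W (fun k a b => rfl) hZherm
    (by rw [hZdet]; have : 0 < t * ‖T.det‖ ^ 2 := by positivity
        linarith)
  have hratio : (∑ k, W k * Z * (W k)ᴴ).det.re / (-Z.det.re)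
      = (p * v / t + t * (u * q) - p * q - u * v) / N ^ 2 := by
    have h1 : (∑ k, W k * Z * (W k)ᴴ).det.re = (p - t * u) * (v - t * q) / ‖S.det‖ ^ 2 := by
      rw [← hXdet]; field_simp
    rw [hZdet, h1, hN, neg_neg]
    field_simp
    ring
  rw [hratio] at hAC
  have hABsq : concurrence (traceLast (pureState ψ)) ^ 2
      ≤ 4 * ((√p * √q - √u * √v) ^ 2 / N ^ 2) := by
    refine (pow_le_pow_left₀ (concurrence_nonneg _) hAB 2).trans_eq ?_
    rw [div_pow, mul_pow, sq_abs]
    ring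
  have hid : 2 * (√(p * v) * √(u * q)) - p * q - u * v = -(√p * √q - √u * √v) ^ 2 := by
    rw [Real.sqrt_mul hp0, Real.sqrt_mul hu0]
    linear_combination √q ^ 2 * Real.sq_sqrt hp0 + p * Real.sq_sqrt hq0
      + √v ^ 2 * Real.sq_sqrt hu0 + u * Real.sq_sqrt hv0
  have hfrac : (p * v / t + t * (u * q) - p * q - u * v) / N ^ 2
      ≤ -((√p * √q - √u * √v) ^ 2 / N ^ 2) + ε / 4 := by
    rw [div_le_iff₀ (by positivity), add_mul, neg_mul, div_mul_cancel₀ _ (by positivity)]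
    linarith
  linarith

end PureMonogamy

/-! ### Invariance under relabelling of the bases -/

section Reindex

open Matrix

variable {ι κ ι' κ' : Type*} [Fintype ι] [Fintype κ] [Fintype ι'] [Fintype κ']

theorem pureConcurrence_comp_prodMap (e : ι ≃ ι') (f : κ ≃ κ') (ψ : ι' × κ' → ℂ) :
    pureConcurrence (ψ ∘ Prod.map e f) = pureConcurrence ψ := by
  have h : traceSecond (pureState (ψ ∘ Prod.map e f))
      = (traceSecond (pureState ψ)).submatrix e e := by
    ext a b
    exact f.sum_comp fun c => pureState ψ (e a, c) (e b, c)
  unfold pureConcurrence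
  rw [h, Matrix.submatrix_mul_equiv]
  congr 4
  exact e.sum_comp fun a => (traceSecond (pureState ψ) * traceSecond (pureState ψ)) a a

theorem IsPureEnsemble.submatrix {N : ℕ} {w : Fin N → ℝ} {ψ : Fin N → ι' × κ' → ℂ}
    {ρ : Matrix (ι' × κ') (ι' × κ') ℂ} (h : IsPureEnsemble w ψ ρ) (e : ι ≃ ι') (f : κ ≃ κ') :
    IsPureEnsemble w (fun i => ψ i ∘ Prod.map e f)
      (ρ.submatrix (Prod.map e f) (Prod.map e f)) where
  nonneg := h.nonneg
  sum_eq_one := h.sum_eq_one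
  isStateVector i := by
    refine Eq.trans ?_ (h.isStateVector i)
    exact (e.prodCongr f).sum_comp fun x => ‖ψ i x‖ ^ 2
  eq_sum := by
    ext x y
    rw [h.eq_sum]
    simp only [Matrix.submatrix_apply, Matrix.sum_apply]
    rfl

theorem concurrence_submatrix (e : ι ≃ ι') (f : κ ≃ κ') (ρ : Matrix (ι' × κ') (ι' × κ') ℂ) :
    concurrence (ρ.submatrix (Prod.map e f) (Prod.map e f)) = concurrence ρ := by
  unfold concurrence
  congr 1
  apply Set.Subset.antisymm
  · rintro c ⟨N, w, ψ, h, rfl⟩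
    refine ⟨N, w, fun i => ψ i ∘ Prod.map e.symm f.symm, ?_, ?_⟩
    · convert h.submatrix e.symm f.symm using 1
      ext ⟨a, b⟩ ⟨a', b'⟩
      simp
    · simp only [pureConcurrence_comp_prodMap]
  · rintro c ⟨N, w, ψ, h, rfl⟩
    exact ⟨N, w, _, h.submatrix e f, by simp only [pureConcurrence_comp_prodMap]⟩

theorem IsDensityMatrix.submatrix {ρ : Matrix ι' ι' ℂ} (h : IsDensityMatrix ρ) (e : ι ≃ ι') :
    IsDensityMatrix (ρ.submatrix e e) :=
  ⟨h.1.submatrix e, by rw [← h.2]; exact e.sum_comp fun a => ρ a a⟩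

end Reindex

/-! ### Monogamy for mixed states -/

section MixedMonogamy

open Matrix

variable {τ : Type*} [Fintype τ]

theorem isDensityMatrix_traceLast_pureState {ι κ : Type*} [Fintype ι] [Fintype κ]
    {ψ : ι × κ × τ → ℂ} (h : IsStateVector ψ) : IsDensityMatrix (traceLast (pureState ψ)) := by
  refine ⟨?_, ?_⟩
  · have : traceLast (pureState ψ)
        = ∑ c, pureState (fun x : ι × κ => ψ (x.1, x.2, c)) := by
      ext u v
      rw [Matrix.sum_apply]
      rfl
    rw [this]
    exact Matrix.posSemidef_sum _ fun c _ => pureState_posSemidef _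
  · rw [trace_traceLast, trace_pureState, show ∑ x, ‖ψ x‖ ^ 2 = 1 from h, Complex.ofReal_one]

theorem isDensityMatrix_traceMiddle_pureState {ι κ : Type*} [Fintype ι] [Fintype κ]
    {ψ : ι × κ × τ → ℂ} (h : IsStateVector ψ) : IsDensityMatrix (traceMiddle (pureState ψ)) := by
  refine ⟨?_, ?_⟩
  · have : traceMiddle (pureState ψ)
        = ∑ b, pureState (fun x : ι × τ => ψ (x.1, b, x.2)) := by
      ext u v
      rw [Matrix.sum_apply]
      rfl
    rw [this]
    exact Matrix.posSemidef_sum _ fun c _ => pureState_posSemidef _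
  · rw [trace_traceMiddle, trace_pureState, show ∑ x, ‖ψ x‖ ^ 2 = 1 from h, Complex.ofReal_one]

/-- Monogamy of the squared concurrence for mixed states of two qubits and a third system. The pure
state inequality passes to convex roofs because the Euclidean norm of the pair of concurrences
satisfies the triangle inequality. -/
theorem concurrence_monogamy {σ : Matrix (Fin 2 × Fin 2 × τ) (Fin 2 × Fin 2 × τ) ℂ}
    (hσ : IsDensityMatrix σ) :
    concurrence (traceLast σ) ^ 2 + concurrence (traceMiddle σ) ^ 2 ≤ concurrence σ ^ 2 := by
  rw [← Real.sqrt_le_left (concurrence_nonneg σ)]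
  obtain ⟨N, w, ψ, h⟩ := hσ.exists_isPureEnsemble
  refine le_csInf ⟨_, N, w, ψ, h, rfl⟩ ?_
  clear h N w ψ
  rintro c ⟨N, w, ψ, h, rfl⟩
  have hlast : traceLast σ = ∑ i, (w i : ℂ) • traceLast (pureState (ψ i)) := by
    ext u v
    rw [h.eq_sum]
    simp only [traceLast, Matrix.sum_apply, Matrix.smul_apply, Matrix.of_apply, smul_eq_mul,
      Finset.mul_sum]
    exact Finset.sum_comm
  have hmid : traceMiddle σ = ∑ i, (w i : ℂ) • traceMiddle (pureState (ψ i)) := by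
    ext u v
    rw [h.eq_sum]
    simp only [traceMiddle, Matrix.sum_apply, Matrix.smul_apply, Matrix.of_apply, smul_eq_mul,
      Finset.mul_sum]
    exact Finset.sum_comm
  have h1 := concurrence_sum_le h.nonneg h.sum_eq_one
    fun i => isDensityMatrix_traceLast_pureState (h.isStateVector i)
  have h2 := concurrence_sum_le h.nonneg h.sum_eq_one
    fun i => isDensityMatrix_traceMiddle_pureState (h.isStateVector i)
  rw [← hlast] at h1
  rw [← hmid] at h2
  set x : Fin N → ℝ := fun i => concurrence (traceLast (pureState (ψ i)))
  set y : Fin N → ℝ := fun i => concurrence (traceMiddle (pureState (ψ i)))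
  calc √(concurrence (traceLast σ) ^ 2 + concurrence (traceMiddle σ) ^ 2)
      ≤ √((∑ i, w i * x i) ^ 2 + (∑ i, w i * y i) ^ 2) := by
        gcongr
        · exact concurrence_nonneg _
        · exact concurrence_nonneg _
    _ = ‖∑ i, (w i : ℂ) * (⟨x i, y i⟩ : ℂ)‖ := by
        rw [Complex.norm_eq_sqrt_sq_add_sq, Complex.re_sum, Complex.im_sum]
        simp
    _ ≤ ∑ i, ‖(w i : ℂ) * (⟨x i, y i⟩ : ℂ)‖ := norm_sum_le _ _
    _ ≤ ∑ i, w i * pureConcurrence (ψ i) := by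
        refine Finset.sum_le_sum fun i _ => ?_
        rw [norm_mul, Complex.norm_real, Real.norm_of_nonneg (h.nonneg i),
          Complex.norm_eq_sqrt_sq_add_sq]
        refine mul_le_mul_of_nonneg_left ?_ (h.nonneg i)
        rw [Real.sqrt_le_left (pureConcurrence_nonneg _)]
        exact concurrence_monogamy_pure (h.isStateVector i)

end MixedMonogamy

/-! ### Reduced states of multi-qubit systems -/

section ReducedStates

open Matrix

variable {ι : Type*} [Fintype ι] [DecidableEq ι]

theorem reducedState_posSemidef {ρ : Matrix (ι → Fin 2) (ι → Fin 2) ℂ} (hρ : ρ.PosSemidef)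
    (A B : Finset ι) : (reducedState ρ A B).PosSemidef := by
  -- The operator `⟨z|` of the qubits outside `A ∪ B`.
  let V : (((A ∪ B)ᶜ : Finset ι) → Fin 2) →
      Matrix ((A → Fin 2) × (B → Fin 2)) (ι → Fin 2) ℂ := fun z =>
    Matrix.of fun u x =>
      if A.restrict x = u.1 ∧ B.restrict x = u.2 ∧ (A ∪ B)ᶜ.restrict x = z then 1 else 0
  have h : reducedState ρ A B = ∑ z, V z * ρ * (V z)ᴴ := by
    ext u v
    have h1 : ∀ z, (V z * ρ * (V z)ᴴ) u v = ∑ x, ∑ y,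
        if A.restrict x = u.1 ∧ B.restrict x = u.2 ∧ A.restrict y = v.1 ∧ B.restrict y = v.2 ∧
          ((A ∪ B)ᶜ.restrict x = z ∧ (A ∪ B)ᶜ.restrict y = z) then ρ x y else 0 := by
      intro z
      rw [Matrix.mul_apply]
      simp only [Matrix.mul_apply, Finset.sum_mul]
      rw [Finset.sum_comm]
      refine Finset.sum_congr rfl fun x _ => Finset.sum_congr rfl fun y _ => ?_
      simp only [V, Matrix.of_apply, Matrix.conjTranspose_apply, apply_ite star, star_one,
        star_zero, ite_mul, mul_ite, one_mul, zero_mul, mul_one, mul_zero, ← ite_and]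
      congr 1
      simp only [eq_iff_iff]
      tauto
    rw [Matrix.sum_apply]
    simp only [h1]
    rw [Finset.sum_comm]
    refine Finset.sum_congr rfl fun x _ => ?_
    rw [Finset.sum_comm]
    refine Finset.sum_congr rfl fun y _ => ?_
    rw [Finset.sum_eq_single ((A ∪ B)ᶜ.restrict x)]
    · congr 1
      simp only [eq_iff_iff, true_and, funext_iff, Subtype.forall, Finset.mem_compl,
        Finset.restrict]
      constructor
      · rintro ⟨h1, h2, h3, h4, h5⟩
        exact ⟨h1, h2, h3, h4, fun q hq => (h5 q hq).symm⟩
      · rintro ⟨h1, h2, h3, h4, h5⟩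
        exact ⟨h1, h2, h3, h4, fun q hq => (h5 q hq).symm⟩
    · intro z _ hz
      rw [if_neg]
      rintro ⟨-, -, -, -, h, -⟩
      exact hz h.symm
    · simp
  rw [h]
  exact Matrix.posSemidef_sum _ fun z _ => hρ.mul_mul_conjTranspose_same _

theorem trace_reducedState (ρ : Matrix (ι → Fin 2) (ι → Fin 2) ℂ) (A B : Finset ι) :
    (reducedState ρ A B).trace = ρ.trace := by
  simp only [Matrix.trace, Matrix.diag_apply, reducedState, Matrix.of_apply]
  rw [Finset.sum_comm]
  refine Finset.sum_congr rfl fun x _ => ?_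
  rw [Finset.sum_comm, Finset.sum_eq_single x]
  · rw [Finset.sum_eq_single (A.restrict x, B.restrict x)]
    · simp
    · rintro ⟨u, u'⟩ _ hu
      rw [if_neg]
      rintro ⟨h1, h2, -⟩
      exact hu (by rw [h1, h2])
    · simp
  · intro y _ hy
    refine Finset.sum_eq_zero fun u _ => if_neg ?_
    rintro ⟨h1, h2, h3, h4, h5⟩
    apply hy
    ext1 q
    by_cases hq : q ∈ A ∪ B
    · rcases Finset.mem_union.1 hq with hq | hq
      · exact congrFun (h3.trans h1.symm) ⟨q, hq⟩
      · exact congrFun (h4.trans h2.symm) ⟨q, hq⟩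
    · exact (h5 q hq).symm
  · simp

theorem isDensityMatrix_reducedState {ρ : Matrix (ι → Fin 2) (ι → Fin 2) ℂ}
    (hρ : IsDensityMatrix ρ) (A B : Finset ι) : IsDensityMatrix (reducedState ρ A B) :=
  ⟨reducedState_posSemidef hρ.1 A B, (trace_reducedState ρ A B).trans hρ.2⟩

/-- Basis states of a set of qubits are pairs of basis states of two complementary subsets. -/
def restrictEquiv {ι : Type*} [DecidableEq ι] {B B₁ B₂ : Finset ι}
    (hB : B = B₁ ∪ B₂) (hd : Disjoint B₁ B₂) :
    (B → Fin 2) ≃ (B₁ → Fin 2) × (B₂ → Fin 2) where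
  toFun f := (fun i => f ⟨i, hB ▸ Finset.mem_union_left _ i.2⟩,
    fun i => f ⟨i, hB ▸ Finset.mem_union_right _ i.2⟩)
  invFun g i := if h : i.1 ∈ B₁ then g.1 ⟨i, h⟩ else
    g.2 ⟨i, (Finset.mem_union.1 (hB ▸ i.2)).resolve_left h⟩
  left_inv f := by
    ext1 i
    by_cases h : i.1 ∈ B₁ <;> simp [h]
  right_inv g := by
    refine Prod.ext ?_ ?_
    · ext1 i
      simp
    · ext1 i
      have : i.1 ∉ B₁ := Finset.disjoint_right.1 hd i.2
      simp [this]

theorem restrict_eq_restrictEquiv_symm {ι : Type*} [DecidableEq ι] {B B₁ B₂ : Finset ι}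
    (hB : B = B₁ ∪ B₂) (hd : Disjoint B₁ B₂) (x : ι → Fin 2) (b : B₁ → Fin 2) (c : B₂ → Fin 2) :
    B.restrict x = (restrictEquiv hB hd).symm (b, c) ↔
      B₁.restrict x = b ∧ B₂.restrict x = c := by
  rw [Equiv.eq_symm_apply, Prod.ext_iff]
  rfl

/-- Tracing out the qubits of `B₂` from the reduced state of `A` and `B₁ ∪ B₂` gives the reduced
state of `A` and `B₁`. The map `G` joins basis states of `B₁` and `B₂`. -/
theorem sum_reducedState (ρ : Matrix (ι → Fin 2) (ι → Fin 2) ℂ) {A B B₁ B₂ : Finset ι}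
    (hB : B = B₁ ∪ B₂) (hd : Disjoint B₁ B₂) (hA : Disjoint A B₂)
    (G : (B₁ → Fin 2) → (B₂ → Fin 2) → B → Fin 2)
    (hG : ∀ (x : ι → Fin 2) b c, B.restrict x = G b c ↔ B₁.restrict x = b ∧ B₂.restrict x = c)
    (u v : A → Fin 2) (b b' : B₁ → Fin 2) :
    ∑ c, reducedState ρ A B (u, G b c) (v, G b' c) = reducedState ρ A B₁ (u, b) (v, b') := by
  simp only [reducedState, Matrix.of_apply, hG]
  rw [Finset.sum_comm]
  refine Finset.sum_congr rfl fun x _ => ?_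
  rw [Finset.sum_comm]
  refine Finset.sum_congr rfl fun y _ => ?_
  rw [Finset.sum_eq_single (B₂.restrict x)]
  · congr 1
    simp only [eq_iff_iff, and_true]
    constructor
    · rintro ⟨h1, h2, h3, ⟨h4, h5⟩, h6⟩
      refine ⟨h1, h2, h3, h4, fun q hq => ?_⟩
      by_cases hq2 : q ∈ B₂
      · exact (congrFun h5 ⟨q, hq2⟩).symm
      · refine h6 q fun h => ?_
        rw [hB] at h
        simp only [Finset.mem_union] at h hq
        tauto
    · rintro ⟨h1, h2, h3, h4, h5⟩
      refine ⟨h1, h2, h3, ⟨h4, ?_⟩, fun q hq => h5 q fun h => hq ?_⟩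
      · ext1 q
        refine (h5 q.1 fun h => ?_).symm
        rcases Finset.mem_union.1 h with h | h
        · exact Finset.disjoint_left.1 hA h q.2
        · exact Finset.disjoint_left.1 hd h q.2
      · rw [hB]
        simp only [Finset.mem_union] at h ⊢
        tauto
  · intro c _ hc
    rw [if_neg]
    rintro ⟨-, ⟨-, h⟩, -⟩
    exact hc h.symm
  · simp

/-- Monogamy of the squared concurrence for the reduced states of a multi-qubit state. -/
theorem concurrence_reducedState_monogamy {ρ : Matrix (ι → Fin 2) (ι → Fin 2) ℂ}
    (hρ : IsDensityMatrix ρ) {A B B₁ B₂ : Finset ι} (hB : B = B₁ ∪ B₂) (hd : Disjoint B₁ B₂)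
    (hA : Disjoint A B) (hA1 : A.card = 1) (hB1 : B₁.card = 1) :
    concurrence (reducedState ρ A B₁) ^ 2 + concurrence (reducedState ρ A B₂) ^ 2
      ≤ concurrence (reducedState ρ A B) ^ 2 := by
  have hAB : Disjoint A B₁ ∧ Disjoint A B₂ := by
    rwa [hB, Finset.disjoint_union_right] at hA
  have equivFin : ∀ s : Finset ι, s.card = 1 → Nonempty (Fin 2 ≃ (s → Fin 2)) := fun s hs =>
    ⟨Fintype.equivOfCardEq (by simp [hs])⟩
  obtain ⟨e⟩ := equivFin A hA1
  obtain ⟨e₁⟩ := equivFin B₁ hB1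
  let g : Fin 2 × (B₂ → Fin 2) ≃ (B → Fin 2) :=
    (e₁.prodCongr (Equiv.refl _)).trans (restrictEquiv hB hd).symm
  let σ := (reducedState ρ A B).submatrix (Prod.map e g) (Prod.map e g)
  have hσ : IsDensityMatrix σ := (isDensityMatrix_reducedState hρ A B).submatrix (e.prodCongr g)
  have hlast : traceLast σ = (reducedState ρ A B₁).submatrix (Prod.map e e₁) (Prod.map e e₁) := by
    ext u v
    exact sum_reducedState ρ hB hd hAB.2 (fun b c => (restrictEquiv hB hd).symm (b, c))
      (restrict_eq_restrictEquiv_symm hB hd) _ _ _ _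
  have hmid : traceMiddle σ = (reducedState ρ A B₂).submatrix
      (Prod.map e (Equiv.refl _)) (Prod.map e (Equiv.refl _)) := by
    ext u v
    have h := sum_reducedState ρ (hB.trans (Finset.union_comm _ _)) hd.symm hAB.1
      (fun c b => (restrictEquiv hB hd).symm (b, c))
      (fun x c b => (restrict_eq_restrictEquiv_symm hB hd x b c).trans and_comm)
      (e u.1) (e v.1) u.2 v.2
    rw [← e₁.sum_comp] at h
    exact h
  have key := concurrence_monogamy hσ
  rwa [hlast, hmid, concurrence_submatrix, concurrence_submatrix, concurrence_submatrix] at key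

end ReducedStates

/-! ### Consecutive tails of the chain of qubits -/

section Qubits

theorem card_qubit {n i : ℕ} (h1 : 1 ≤ i) (hn : i ≤ n) : (qubit n i).card = 1 := by
  rw [Finset.card_eq_one]
  refine ⟨⟨i - 1, by omega⟩, ?_⟩
  ext q
  simp only [qubit, Finset.mem_filter, Finset.mem_univ, true_and, Finset.mem_singleton,
    Fin.ext_iff]
  omega

theorem pairConcurrence_nonneg {n : ℕ} (ρ : Matrix (Fin n → Fin 2) (Fin n → Fin 2) ℂ) (i : ℕ) :
    0 ≤ pairConcurrence ρ i := concurrence_nonneg _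

theorem tailConcurrence_nonneg {n : ℕ} (ρ : Matrix (Fin n → Fin 2) (Fin n → Fin 2) ℂ) (i : ℕ) :
    0 ≤ tailConcurrence ρ i := concurrence_nonneg _

theorem tailConcurrence_last {n : ℕ} (ρ : Matrix (Fin n → Fin 2) (Fin n → Fin 2) ℂ) :
    tailConcurrence ρ n = pairConcurrence ρ n := by
  have : qubitsFrom n n = qubit n n := by
    ext q
    simp only [qubit, qubitsFrom, Finset.mem_filter, Finset.mem_univ, true_and]
    omega
  rw [tailConcurrence, pairConcurrence, this]

theorem tailConcurrence_monogamy {n : ℕ} {ρ : Matrix (Fin n → Fin 2) (Fin n → Fin 2) ℂ}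
    (hρ : IsDensityMatrix ρ) {j : ℕ} (hj : 2 ≤ j) (hjn : j ≤ n) :
    pairConcurrence ρ j ^ 2 + tailConcurrence ρ (j + 1) ^ 2 ≤ tailConcurrence ρ j ^ 2 := by
  refine concurrence_reducedState_monogamy hρ ?_ ?_ ?_ (card_qubit le_rfl (by omega))
    (card_qubit (by omega) hjn)
  · ext q
    simp only [qubit, qubitsFrom, Finset.mem_filter, Finset.mem_univ, true_and, Finset.mem_union]
    omega
  · rw [Finset.disjoint_left]
    intro q
    simp only [qubit, qubitsFrom, Finset.mem_filter, Finset.mem_univ, true_and]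
    omega
  · rw [Finset.disjoint_left]
    intro q
    simp only [qubit, qubitsFrom, Finset.mem_filter, Finset.mem_univ, true_and]
    omega

end Qubits

/-! ### Inequalities for real powers and their iteration -/

section RealInequalities

theorem one_add_rpow_sub_one_le {k p x : ℝ} (hk : 1 ≤ k) (hp : 1 / 2 ≤ p)
    (hx : 0 ≤ x) (hx2 : x ≤ 1 / 2) : (1 + k) ^ (x - 1) ≤ p ^ x :=
  calc (1 + k) ^ (x - 1) ≤ 2 ^ (x - 1) :=
        Real.rpow_le_rpow_of_nonpos (by norm_num) (by linarith) (by linarith)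
    _ ≤ 2 ^ (-x) := Real.rpow_le_rpow_of_exponent_le (by norm_num) (by linarith)
    _ = (1 / 2) ^ x := by
        rw [one_div, Real.inv_rpow (by norm_num), Real.rpow_neg (by norm_num)]
    _ ≤ p ^ x := Real.rpow_le_rpow (by norm_num) hp hx

/-- The weight, bounded by the value that makes `s ↦ (1 + s) ^ x - l * s ^ x` monotone on
`[k, ∞)`. -/
theorem weight_le {k p x : ℝ} (hk : 1 ≤ k) (hp : 1 / 2 ≤ p) (hx : 0 ≤ x) (hx2 : x ≤ 1 / 2) :
    ((1 + k) ^ x - p ^ x) / k ^ x ≤ (k / (1 + k)) ^ (1 - x) := by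
  have hk0 : 0 < k := by linarith
  have hk1 : 0 < 1 + k := by linarith
  rw [div_le_iff₀ (Real.rpow_pos_of_pos hk0 x), Real.div_rpow hk0.le hk1.le]
  have h1 : k ^ (1 - x) / (1 + k) ^ (1 - x) * k ^ x = k * (1 + k) ^ (x - 1) := by
    rw [show x - 1 = -(1 - x) by ring, Real.rpow_neg hk1.le, div_mul_eq_mul_div,
      ← Real.rpow_add hk0, sub_add_cancel, Real.rpow_one, div_eq_mul_inv]
  have h2 : (1 + k) ^ x = (1 + k) * (1 + k) ^ (x - 1) := by
    rw [Real.rpow_sub_one hk1.ne']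
    field_simp
  rw [h1, h2]
  linarith [one_add_rpow_sub_one_le hk hp hx hx2]

theorem weight_nonneg {k p x : ℝ} (hk : 1 ≤ k) (hp : 1 / 2 ≤ p) (hp1 : p ≤ 1) (hx : 0 ≤ x) :
    0 ≤ ((1 + k) ^ x - p ^ x) / k ^ x := by
  refine div_nonneg (sub_nonneg.2 ?_) (Real.rpow_nonneg (by linarith) x)
  exact Real.rpow_le_rpow (by linarith) (by linarith) hx

/-- The inequality `p ^ x * a ^ x + l * b ^ x ≤ (a + b) ^ x` for `a = 1` and `b = s`, which is an
equality at `s = k` by the choice of the weight `l`. -/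
theorem rpow_add_weight_mul_rpow_le {k p x s : ℝ} (hk : 1 ≤ k) (hp : 1 / 2 ≤ p)
    (hx : 0 ≤ x) (hx2 : x ≤ 1 / 2) (hs : k ≤ s) :
    p ^ x + ((1 + k) ^ x - p ^ x) / k ^ x * s ^ x ≤ (1 + s) ^ x := by
  set l := ((1 + k) ^ x - p ^ x) / k ^ x with hl
  have hk0 : 0 < k := by linarith
  have hder : ∀ t : ℝ, k ≤ t → HasDerivAt (fun t : ℝ => (1 + t) ^ x - l * t ^ x)
      (x * ((1 + t) ^ (x - 1) - l * t ^ (x - 1))) t := by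
    intro t ht
    have h1 : HasDerivAt (fun t : ℝ => (1 + t) ^ x) (1 * x * (1 + t) ^ (x - 1)) t :=
      ((hasDerivAt_id t).const_add 1).rpow_const (Or.inl (by simp only [id]; linarith))
    have h2 : HasDerivAt (fun t : ℝ => t ^ x) (x * t ^ (x - 1)) t :=
      Real.hasDerivAt_rpow_const (Or.inl (by linarith))
    exact (h1.sub (h2.const_mul l)).congr_deriv (by ring)
  have hmono : MonotoneOn (fun t : ℝ => (1 + t) ^ x - l * t ^ x) (Set.Ici k) := by
    refine monotoneOn_of_deriv_nonneg (convex_Ici k)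
      (fun t ht => (hder t ht).continuousAt.continuousWithinAt)
      (fun t ht => (hder t (interior_subset ht)).differentiableAt.differentiableWithinAt) ?_
    intro t ht
    have ht : k ≤ t := interior_subset ht
    have ht0 : 0 < t := by linarith
    have ht1 : 0 < 1 + t := by linarith
    rw [(hder t ht).deriv]
    refine mul_nonneg hx (sub_nonneg.2 ?_)
    have h1 : l ≤ (t / (1 + t)) ^ (1 - x) := (weight_le hk hp hx hx2).trans
      (Real.rpow_le_rpow (by positivity)
        (by rw [div_le_div_iff₀ (by linarith) ht1]; nlinarith) (by linarith))
    calc l * t ^ (x - 1) ≤ (t / (1 + t)) ^ (1 - x) * t ^ (x - 1) :=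
          mul_le_mul_of_nonneg_right h1 (Real.rpow_nonneg ht0.le _)
      _ = (1 + t) ^ (x - 1) := by
          rw [Real.div_rpow ht0.le ht1.le, div_mul_eq_mul_div, ← Real.rpow_add ht0,
            show 1 - x + (x - 1) = 0 by ring, Real.rpow_zero, show x - 1 = -(1 - x) by ring,
            Real.rpow_neg ht1.le, one_div]
  have h := hmono (Set.mem_Ici.2 le_rfl) (Set.mem_Ici.2 hs) hs
  have hlk : l * k ^ x = (1 + k) ^ x - p ^ x :=
    div_mul_cancel₀ _ (Real.rpow_pos_of_pos hk0 x).ne'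
  simp only [hlk] at h
  linarith

/-- For `a = 0 < x` the inequality says that the weight is at most one; for `x = 0` the weight
vanishes and `0 ^ 0 = 1`. -/
theorem rpow_mul_rpow_add_weight_le {k p x a b : ℝ} (hk : 1 ≤ k) (hp : 1 / 2 ≤ p)
    (hx : 0 ≤ x) (hx2 : x ≤ 1 / 2) (ha : 0 ≤ a) (hab : k * a ≤ b) :
    p ^ x * a ^ x + ((1 + k) ^ x - p ^ x) / k ^ x * b ^ x ≤ (a + b) ^ x := by
  have hb : 0 ≤ b := (mul_nonneg (by linarith) ha).trans hab
  rcases ha.eq_or_lt with rfl | ha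
  · rcases hx.eq_or_lt with rfl | hx0
    · simp
    · rw [Real.zero_rpow hx0.ne', mul_zero, zero_add, zero_add]
      refine mul_le_of_le_one_left (Real.rpow_nonneg hb x) ((weight_le hk hp hx hx2).trans ?_)
      exact Real.rpow_le_one (by positivity) (div_le_one_of_le₀ (by linarith) (by linarith))
        (by linarith)
  · have h := rpow_add_weight_mul_rpow_le hk hp hx hx2 ((le_div_iff₀ ha).2 hab)
    have h' := mul_le_mul_of_nonneg_right h (Real.rpow_nonneg ha.le x)
    have h1 : (b / a) ^ x * a ^ x = b ^ x := by
      rw [← Real.mul_rpow (by positivity) ha.le, div_mul_cancel₀ _ ha.ne']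
    have h2 : (1 + b / a) ^ x * a ^ x = (a + b) ^ x := by
      rw [← Real.mul_rpow (by positivity) ha.le, add_mul, one_mul, div_mul_cancel₀ _ ha.ne']
    rwa [h2, add_mul, mul_assoc, h1] at h'

theorem rpow_add_rpow_le_of_sq {a b c r : ℝ} (ha : 0 ≤ a) (hb : 0 ≤ b) (hc : 0 ≤ c)
    (hr : 2 ≤ r) (h : a ^ 2 + b ^ 2 ≤ c ^ 2) : a ^ r + b ^ r ≤ c ^ r := by
  have key : ∀ z : ℝ, 0 ≤ z → (z ^ 2) ^ (r / 2) = z ^ r := by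
    intro z hz
    rw [← Real.rpow_natCast_mul hz]
    congr 1
    push_cast
    ring
  calc a ^ r + b ^ r = (a ^ 2) ^ (r / 2) + (b ^ 2) ^ (r / 2) := by rw [key a ha, key b hb]
    _ ≤ (a ^ 2 + b ^ 2) ^ (r / 2) :=
        Real.add_rpow_le_rpow_add (by positivity) (by positivity) (by linarith)
    _ ≤ (c ^ 2) ^ (r / 2) := Real.rpow_le_rpow (by positivity) h (by linarith)
    _ = c ^ r := key c hc

/-- A monogamy inequality for squares gives a weighted one for `α`-th powers. -/
theorem rpow_mul_rpow_add_weight_le_of_sq {k p α r a b c : ℝ} (hk : 1 ≤ k) (hp : 1 / 2 ≤ p)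
    (hα : 0 ≤ α) (hαr : α ≤ r / 2) (hr : 2 ≤ r) (ha : 0 ≤ a) (hb : 0 ≤ b) (hc : 0 ≤ c)
    (h : a ^ 2 + b ^ 2 ≤ c ^ 2) (hab : k * a ^ r ≤ b ^ r) :
    p ^ (α / r) * a ^ α + monogamyWeight k p α r * b ^ α ≤ c ^ α := by
  have hr0 : 0 < r := by linarith
  have hx : 0 ≤ α / r := div_nonneg hα hr0.le
  have hx2 : α / r ≤ 1 / 2 := by rw [div_le_iff₀ hr0]; linarith
  have key : ∀ z : ℝ, 0 ≤ z → (z ^ r) ^ (α / r) = z ^ α := by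
    intro z hz
    rw [← Real.rpow_mul hz, mul_div_cancel₀ _ hr0.ne']
  have h1 := rpow_mul_rpow_add_weight_le hk hp hx hx2 (Real.rpow_nonneg ha r) hab
  rw [key a ha, key b hb] at h1
  refine h1.trans ?_
  rw [← key c hc]
  exact Real.rpow_le_rpow (add_nonneg (Real.rpow_nonneg ha r) (Real.rpow_nonneg hb r))
    (rpow_add_rpow_le_of_sq ha hb hc hr h) hx

theorem iterate_tail_dominant {P l : ℝ} (hl : 0 ≤ l) {f F : ℕ → ℝ} (d : ℕ)
    (h : ∀ i ∈ Finset.Icc 2 (d + 1), P * f i + l * F (i + 1) ≤ F i) :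
    P * ∑ i ∈ Finset.Icc 2 (d + 1), l ^ (i - 2) * f i + l ^ d * F (d + 2) ≤ F 2 := by
  induction d with
  | zero => simp
  | succ d ih =>
    have h1 := ih fun i hi => h i (by simp only [Finset.mem_Icc] at hi ⊢; omega)
    have h2 := mul_le_mul_of_nonneg_left
      (h (d + 2) (by simp only [Finset.mem_Icc]; omega)) (pow_nonneg hl d)
    rw [Finset.sum_Icc_succ_top (by omega)]
    have e : d + 1 + 1 - 2 = d := by omega
    rw [e]
    change P * (_ + l ^ d * f (d + 2)) + l ^ (d + 1) * F (d + 2 + 1) ≤ F 2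
    rw [pow_succ]
    linarith

theorem iterate_pair_dominant {P l : ℝ} (hP : 0 ≤ P) {f F : ℕ → ℝ} (s d : ℕ)
    (h : ∀ j ∈ Finset.Ico s (s + d), l * f j + P * F (j + 1) ≤ F j) :
    l * ∑ j ∈ Finset.Ico s (s + d), P ^ (j - s) * f j + P ^ d * F (s + d) ≤ F s := by
  induction d with
  | zero => simp
  | succ d ih =>
    have h1 := ih fun i hi => h i (by simp only [Finset.mem_Ico] at hi ⊢; omega)
    have h2 := mul_le_mul_of_nonneg_left
      (h (s + d) (by simp only [Finset.mem_Ico]; omega)) (pow_nonneg hP d)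
    rw [← add_assoc, Finset.sum_Ico_succ_top (by omega), Nat.add_sub_cancel_left, pow_succ]
    linarith

end RealInequalities

/-! ### The weighted monogamy relations -/

theorem theorem2 (n : ℕ) (ρ : Matrix (Fin n → Fin 2) (Fin n → Fin 2) ℂ)
    (hρ : IsDensityMatrix ρ) (k p α r : ℝ) (hk : 1 ≤ k) (hp : 1 / 2 ≤ p) (hp1 : p ≤ 1)
    (hα : 0 ≤ α) (hαr : α ≤ r / 2) (hr : 2 ≤ r) :
    (∀ m : ℕ, 2 ≤ m → m + 2 ≤ n →
      (∀ i ∈ Finset.Icc 2 m,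
        k * pairConcurrence ρ i ^ r ≤ tailConcurrence ρ (i + 1) ^ r) →
      (∀ j ∈ Finset.Icc (m + 1) (n - 1),
        k * tailConcurrence ρ (j + 1) ^ r ≤ pairConcurrence ρ j ^ r) →
      p ^ (α / r) *
          ∑ i ∈ Finset.Icc 2 m, monogamyWeight k p α r ^ (i - 2) * pairConcurrence ρ i ^ α
        + monogamyWeight k p α r ^ m *
          ∑ j ∈ Finset.Icc (m + 1) (n - 1),
            p ^ (((j : ℝ) - m - 1) * α / r) * pairConcurrence ρ j ^ α
        + monogamyWeight k p α r ^ (m - 1) * p ^ (((n : ℝ) - m - 1) * α / r) *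
            pairConcurrence ρ n ^ α
        ≤ tailConcurrence ρ 2 ^ α) ∧
    (3 ≤ n →
      (∀ i ∈ Finset.Icc 2 (n - 1),
        k * pairConcurrence ρ i ^ r ≤ tailConcurrence ρ (i + 1) ^ r) →
      p ^ (α / r) *
          ∑ i ∈ Finset.Icc 2 (n - 1),
            monogamyWeight k p α r ^ (i - 2) * pairConcurrence ρ i ^ α
        + monogamyWeight k p α r ^ (n - 2) * pairConcurrence ρ n ^ α
        ≤ tailConcurrence ρ 2 ^ α) ∧
    (3 ≤ n →
      (∀ j ∈ Finset.Icc 2 (n - 1),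
        k * tailConcurrence ρ (j + 1) ^ r ≤ pairConcurrence ρ j ^ r) →
      monogamyWeight k p α r *
          ∑ j ∈ Finset.Icc 2 (n - 1),
            p ^ (((j : ℝ) - 2) * α / r) * pairConcurrence ρ j ^ α
        + p ^ (((n : ℝ) - 2) * α / r) * pairConcurrence ρ n ^ α
        ≤ tailConcurrence ρ 2 ^ α) := by
  have hp0 : 0 ≤ p := by linarith
  set l := monogamyWeight k p α r with hl
  have hl0 : 0 ≤ l := weight_nonneg hk hp hp1 (div_nonneg hα (by linarith))
  set P := p ^ (α / r) with hP
  have hP0 : 0 ≤ P := Real.rpow_nonneg hp0 _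
  have hpow : ∀ (z : ℝ) (d : ℕ), z = d → p ^ (z * α / r) = P ^ d := by
    intro z d hz
    rw [hP, ← Real.rpow_mul_natCast hp0, hz]
    congr 1
    ring
  have tail_dominant : ∀ i, 2 ≤ i → i ≤ n →
      k * pairConcurrence ρ i ^ r ≤ tailConcurrence ρ (i + 1) ^ r →
      P * pairConcurrence ρ i ^ α + l * tailConcurrence ρ (i + 1) ^ α
        ≤ tailConcurrence ρ i ^ α := fun i hi hin h =>
    rpow_mul_rpow_add_weight_le_of_sq hk hp hα hαr hr (pairConcurrence_nonneg ρ i)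
      (tailConcurrence_nonneg ρ _) (tailConcurrence_nonneg ρ i)
      (tailConcurrence_monogamy hρ hi hin) h
  have pair_dominant : ∀ j, 2 ≤ j → j ≤ n →
      k * tailConcurrence ρ (j + 1) ^ r ≤ pairConcurrence ρ j ^ r →
      l * pairConcurrence ρ j ^ α + P * tailConcurrence ρ (j + 1) ^ α
        ≤ tailConcurrence ρ j ^ α := fun j hj hjn h => by
    rw [add_comm]
    exact rpow_mul_rpow_add_weight_le_of_sq hk hp hα hαr hr (tailConcurrence_nonneg ρ _)
      (pairConcurrence_nonneg ρ j) (tailConcurrence_nonneg ρ j)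
      (by rw [add_comm]; exact tailConcurrence_monogamy hρ hj hjn) h
  have hIcc : ∀ s, 1 ≤ n → Finset.Icc s (n - 1) = Finset.Ico s n := by
    intro s hn
    ext j
    simp only [Finset.mem_Icc, Finset.mem_Ico]
    omega
  -- The contribution of the qubits `A_s, …, A_n` when each pair dominates the rest.
  have pair_part : ∀ s, 2 ≤ s → s ≤ n →
      (∀ j ∈ Finset.Ico s n, k * tailConcurrence ρ (j + 1) ^ r ≤ pairConcurrence ρ j ^ r) →
      l * ∑ j ∈ Finset.Ico s n, P ^ (j - s) * pairConcurrence ρ j ^ α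
        + P ^ (n - s) * pairConcurrence ρ n ^ α ≤ tailConcurrence ρ s ^ α := by
    intro s hs hsn h
    obtain ⟨d, rfl⟩ := Nat.exists_eq_add_of_le hsn
    have := iterate_pair_dominant hP0 (f := fun j => pairConcurrence ρ j ^ α)
      (F := fun j => tailConcurrence ρ j ^ α) s d fun j hj =>
        pair_dominant j (by simp only [Finset.mem_Ico] at hj; omega)
          (by simp only [Finset.mem_Ico] at hj; omega) (h j hj)
    simp only [tailConcurrence_last] at this
    rwa [Nat.add_sub_cancel_left]
  refine ⟨?_, ?_, ?_⟩
  · intro m hm hmn h1 h2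
    obtain ⟨d, rfl⟩ : ∃ d, m = d + 1 := ⟨m - 1, by omega⟩
    have hI := iterate_tail_dominant hl0 (P := P) (f := fun j => pairConcurrence ρ j ^ α)
      (F := fun j => tailConcurrence ρ j ^ α) d fun i hi =>
        tail_dominant i (by simp only [Finset.mem_Icc] at hi; omega)
          (by simp only [Finset.mem_Icc] at hi; omega) (h1 i hi)
    rw [hIcc _ (by omega)] at h2 ⊢
    have hII := mul_le_mul_of_nonneg_left (pair_part (d + 1 + 1) (by omega) (by omega) h2)
      (pow_nonneg hl0 d)
    have hsum : ∑ j ∈ Finset.Ico (d + 1 + 1) n,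
        p ^ (((j : ℝ) - ((d + 1 : ℕ) : ℝ) - 1) * α / r) * pairConcurrence ρ j ^ α
        = ∑ j ∈ Finset.Ico (d + 1 + 1) n, P ^ (j - (d + 1 + 1)) * pairConcurrence ρ j ^ α := by
      refine Finset.sum_congr rfl fun j hj => ?_
      rw [hpow _ (j - (d + 1 + 1))]
      rw [Nat.cast_sub (Finset.mem_Ico.1 hj).1]
      push_cast
      ring
    rw [hsum, hpow _ (n - (d + 1 + 1)) (by
      rw [Nat.cast_sub (by omega)]; push_cast; ring), Nat.add_sub_cancel, pow_succ]
    linarith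
  · intro hn h
    obtain ⟨d, rfl⟩ : ∃ d, n = d + 2 := ⟨n - 2, by omega⟩
    have hI := iterate_tail_dominant hl0 (P := P) (f := fun j => pairConcurrence ρ j ^ α)
      (F := fun j => tailConcurrence ρ j ^ α) d fun i hi =>
        tail_dominant i (by simp only [Finset.mem_Icc] at hi; omega)
          (by simp only [Finset.mem_Icc] at hi; omega) (h i hi)
    simp only [tailConcurrence_last] at hI
    exact hI
  · intro hn h
    rw [hIcc _ (by omega)] at h ⊢
    have hII := pair_part 2 le_rfl (by omega) h
    have hsum : ∑ j ∈ Finset.Ico 2 n, p ^ (((j : ℝ) - 2) * α / r) * pairConcurrence ρ j ^ α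
        = ∑ j ∈ Finset.Ico 2 n, P ^ (j - 2) * pairConcurrence ρ j ^ α := by
      refine Finset.sum_congr rfl fun j hj => ?_
      rw [hpow _ (j - 2)]
      rw [Nat.cast_sub (Finset.mem_Ico.1 hj).1]
      push_cast
      ring
    rw [hsum, hpow _ (n - 2) (by rw [Nat.cast_sub (by omega)]; push_cast; ring)]
    exact hII
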